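/- Let $n\in\mathbb N$ and let $\mathscr A,\mathscr B_1,\mathscr B_2\subseteq\mathbb N^n$ be finite sets with $\mathscr A\subseteq(2\mathbb N)^n$, $\mathscr B_1\subseteq\mathrm{conv}(\mathscr A)\cap(2\mathbb N)^n$, $\mathscr B_2\subseteq\mathrm{conv}(\mathscr A)\cap(\mathbb N^n\setminus(2\mathbb N)^n)$ and $\mathscr A\cap\mathscr B_1=\varnothing$. A circuit polynomial is a polynomial $\sum_{\alpha\in T}c_\alpha\mathbf x^\alpha-d\,\mathbf x^\beta\in\mathbb R[x_1,\dots,x_n]$ such that $T\subseteq(2\mathbb N)^n$ is the vertex set of a simplex, $c_\alpha>0$ for all $\alpha\in T$, $d\in\mathbb R$, and $\beta\in\mathbb N^n$ lies in the relative interior of that simplex. Let $\mathrm{SONC}$ be the set of finite (possibly empty) sums of circuit polynomials that are nonnegative on $\mathbb R^n$ and of monomial squares $c\,\mathbf x^\alpha$ with $c\ge0$, $\alpha\in(2\mathbb N)^n$. With $\mathbb R_+=[0,\infty)$, let $$\mathrm{SONC}_{\mathscr A,\mathscr B_1,\mathscr B_2}=\Big\{(\mathbf c,\mathbf d_1,\mathbf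 d_2)\in\mathbb R_+^{|\mathscr A|}\times\mathbb R_+^{|\mathscr B_1|}\times\mathbb R^{|\mathscr B_2|}\;\Big|\;\sum_{\alpha\in\mathscr A}c_\alpha\mathbf x^\alpha-\sum_{\beta\in\mathscr B_1\cup\mathscr B_2}d_\beta\mathbf x^\beta\in\mathrm{SONC}\Big\},$$ where $\mathbf c=(c_\alpha)_{\alpha\in\mathscr A}$ and $\mathbf d_i=(d_\beta)_{\beta\in\mathscr B_i}$. For a cone $Q$ in a real vector space $E$, a set $C$ in a real vector space $W$ has a $Q^k$-lift if there are a linear subspace $L\subseteq E^k$ and a linear map $\pi\colon E^k\to W$ with $C=\pi(Q^k\cap L)$. Then $\mathrm{SONC}_{\mathscr A,\mathscr B_1,\mathscr B_2}$ admits a second-order cone representation: for some $k\in\mathbb N$ it has an $(\mathbb S^2_+)^k$-lift, where $\mathbb S^2_+$ is the cone of positive semidefinite real symmetric $2\times2$ matrices, and equally a $(\mathbf K^3)^k$-lift, where $\mathbf K^3=\{a\in\mathbb R^3\mid 2a_1a_2\ge a_3^2,\ a_1\ge0,\ a_2\ge0\}$ is the $3$-dimensional rotated second-order cone. -/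

import Mathlib

open MvPolynomial

/-- The lattice points of `(2ℕ)ⁿ`. -/
def IsEvenPt {n : ℕ} (α : Fin n →₀ ℕ) : Prop := ∀ i, Even (α i)

/-- The inclusion `ℕⁿ ⊆ ℝⁿ`. -/
def toRealPt {n : ℕ} (α : Fin n →₀ ℕ) : Fin n → ℝ := fun i => (α i : ℝ)

/-- The convex hull in `ℝⁿ` of a finite set of lattice points. -/
def latticeConv {n : ℕ} (A : Finset (Fin n →₀ ℕ)) : Set (Fin n → ℝ) :=
  convexHull ℝ (toRealPt '' (A : Set (Fin n →₀ ℕ)))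

/-- `β` lies in the (relative) interior of the simplex with vertex set `A`: the points of `A` are
affinely independent, and `β` is a convex combination of all of them with positive weights. -/
def InSimplexInterior {n : ℕ} (A : Finset (Fin n →₀ ℕ)) (β : Fin n →₀ ℕ) : Prop :=
  AffineIndependent ℝ (fun α : A => toRealPt (α : Fin n →₀ ℕ)) ∧
    ∃ w : (Fin n →₀ ℕ) → ℝ, (∀ α ∈ A, 0 < w α) ∧ ∑ α ∈ A, w α = 1 ∧
      ∑ α ∈ A, w α • toRealPt α = toRealPt β

/-- Circuit polynomials `∑_{α ∈ A} c_α x^α - d x^β`. -/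
def IsCircuitPoly {n : ℕ} (f : MvPolynomial (Fin n) ℝ) : Prop :=
  ∃ (A : Finset (Fin n →₀ ℕ)) (β : Fin n →₀ ℕ) (c : (Fin n →₀ ℕ) → ℝ) (d : ℝ),
    (∀ α ∈ A, IsEvenPt α) ∧ (∀ α ∈ A, 0 < c α) ∧ InSimplexInterior A β ∧
      f = (∑ α ∈ A, monomial α (c α)) - monomial β d

/-- Nonnegativity on all of `ℝⁿ`. -/
def IsNonnegPoly {n : ℕ} (f : MvPolynomial (Fin n) ℝ) : Prop :=
  ∀ x : Fin n → ℝ, 0 ≤ eval x f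

/-- Monomial squares `c x^α` with `α` even and `c ≥ 0`. -/
def IsMonomialSquare {n : ℕ} (f : MvPolynomial (Fin n) ℝ) : Prop :=
  ∃ (α : Fin n →₀ ℕ) (c : ℝ), IsEvenPt α ∧ 0 ≤ c ∧ f = monomial α c

/-- The (additive monoid of all) sums of nonnegative circuit polynomials; monomial squares count as nonnegative
circuit polynomials, and the empty sum is allowed. -/
noncomputable def SONC (n : ℕ) : AddSubmonoid (MvPolynomial (Fin n) ℝ) :=
  AddSubmonoid.closure {f | (IsCircuitPoly f ∧ IsNonnegPoly f) ∨ IsMonomialSquare f}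

/-- The polynomial `∑_{α ∈ A} c_α x^α - ∑_{β ∈ B₁} d_β x^β - ∑_{β ∈ B₂} d_β x^β`. -/
noncomputable def supportedPoly {n : ℕ} {A B₁ B₂ : Finset (Fin n →₀ ℕ)}
    (v : (A → ℝ) × (B₁ → ℝ) × (B₂ → ℝ)) : MvPolynomial (Fin n) ℝ :=
  (∑ α : A, monomial (α : Fin n →₀ ℕ) (v.1 α))
    - ((∑ β : B₁, monomial (β : Fin n →₀ ℕ) (v.2.1 β))
      + ∑ β : B₂, monomial (β : Fin n →₀ ℕ) (v.2.2 β))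

/-- The SONC cone supported on `A, B₁, B₂`, as a set of coefficient vectors in
`ℝ₊^|A| × ℝ₊^|B₁| × ℝ^|B₂|`, where `ℝ₊` is the set of nonnegative reals. -/
def SONCCone {n : ℕ} (A B₁ B₂ : Finset (Fin n →₀ ℕ)) :
    Set ((A → ℝ) × (B₁ → ℝ) × (B₂ → ℝ)) :=
  {v | (∀ α, 0 ≤ v.1 α) ∧ (∀ β, 0 ≤ v.2.1 β) ∧ supportedPoly v ∈ SONC n}

/-- `C` has a `Q^k`-lift: it is the image, under a linear map, of the intersection of the
`k`-fold product of `Q` with a linear subspace of the ambient space. -/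
def HasConeLift {E W : Type*} [AddCommGroup E] [Module ℝ E] [AddCommGroup W] [Module ℝ W]
    (Q : Set E) (k : ℕ) (C : Set W) : Prop :=
  ∃ (L : Submodule ℝ (Fin k → E)) (φ : (Fin k → E) →ₗ[ℝ] W),
    C = φ '' ({q | ∀ i, q i ∈ Q} ∩ (L : Set (Fin k → E)))

/-- The cone of (symmetric) positive semidefinite real `2 × 2` matrices. -/
def psdTwo : Set (Matrix (Fin 2) (Fin 2) ℝ) := {M | M.PosSemidef}

/-- The rotated second-order cone of dimension `m + 2`:
`2 a₁ a₂ ≥ a₃² + ⋯ + a_{m+2}²`, `a₁ ≥ 0`, `a₂ ≥ 0`. -/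
def rotatedSOC (m : ℕ) : Set (Fin (m + 2) → ℝ) :=
  {a | ∑ i : Fin m, a i.succ.succ ^ 2 ≤ 2 * a 0 * a 1 ∧ 0 ≤ a 0 ∧ 0 ≤ a 1}

/-! The key fact is control of supports: if the polynomial of a coefficient vector is SONC, it is
already a sum of monomial squares on `A` and of circuits with outer exponents in `A` and inner
exponent in `B₁ ∪ B₂`. There are only finitely many such circuits, so the cone is the preimage of a
finite Minkowski sum, `circuitSum`, cut by sign conditions. Lifts survive sums, intersections and
linear preimages, hence one circuit at a time suffices. For a circuit the condition is `|d| ≤ ∏ (c α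
/ w α) ^ w α`. The barycentric coordinates `w` of a lattice point are rational, so this is an
inequality between integer powers, which a binary tree of constraints `z² ≤ x y` expresses.

Support control is `mem_circuitSum_of_mem_SONC`. Summands are grouped by inner exponent into AGE
polynomials, where at most one term may be negative or of odd type. `exists_absorb` and
`exists_eliminate` then trade multiples of one summand against the others until no exponent cancels
outside the given support. For each resulting AGE polynomial, `exists_entropy_dual` provides weights
`ν` certifying nonnegativity by a weighted geometric mean. The support of `ν` need not be a simplex;
`certificate_mem` moves `ν` both ways along an affine relation, in the manner of Carathéodory, until
only circuits are left. -/

open scoped Pointwise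

/-! ### Calculus of second-order cone lifts. -/

/-- The cone of `2 × 2` positive semidefinite symmetric matrices, in coordinates
`(a₁₁, a₂₂, a₁₂)`. -/
def socBase : Set (ℝ × ℝ × ℝ) :=
  {p | 0 ≤ p.1 ∧ 0 ≤ p.2.1 ∧ p.2.2 ^ 2 ≤ p.1 * p.2.1}

section ConeLift

variable {E E' W W' : Type*} [AddCommGroup E] [Module ℝ E] [AddCommGroup E'] [Module ℝ E']
  [AddCommGroup W] [Module ℝ W] [AddCommGroup W'] [Module ℝ W']

lemma HasConeLift.of_fintype {ι : Type*} [Fintype ι] {Q : Set E} {C : Set W}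
    (L : Submodule ℝ (ι → E)) (φ : (ι → E) →ₗ[ℝ] W)
    (h : C = φ '' ({q | ∀ i, q i ∈ Q} ∩ (L : Set (ι → E)))) :
    HasConeLift Q (Fintype.card ι) C := by
  let e : (Fin (Fintype.card ι) → E) ≃ₗ[ℝ] (ι → E) :=
    LinearEquiv.funCongrLeft ℝ E (Fintype.equivFin ι)
  refine ⟨L.comap e.toLinearMap, φ ∘ₗ e.toLinearMap, ?_⟩
  rw [h]
  ext w
  constructor
  · rintro ⟨q, ⟨hq, hL⟩, rfl⟩
    refine ⟨e.symm q, ⟨fun i => ?_, ?_⟩, by simp⟩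
    · exact hq _
    · simpa using hL
  · rintro ⟨q, ⟨hq, hL⟩, rfl⟩
    exact ⟨e q, ⟨fun i => hq _, hL⟩, rfl⟩

/-- A lift through the linear image `Q` of a cone `Q'` is also a lift through `Q'`. -/
lemma HasConeLift.of_image {Q : Set E} {Q' : Set E'} (T : E' →ₗ[ℝ] E) (hT : T '' Q' = Q)
    {k : ℕ} {C : Set W} (h : HasConeLift Q k C) : HasConeLift Q' k C := by
  obtain ⟨L, φ, rfl⟩ := h
  let Tk : (Fin k → E') →ₗ[ℝ] (Fin k → E) := LinearMap.compLeft T (Fin k)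
  refine ⟨L.comap Tk, φ ∘ₗ Tk, ?_⟩
  ext w
  constructor
  · rintro ⟨q, ⟨hq, hL⟩, rfl⟩
    have : ∀ i, ∃ p ∈ Q', T p = q i := fun i => by
      have := hq i
      rw [← hT] at this
      exact this
    choose p hp hpq using this
    have hTp : Tk p = q := funext hpq
    exact ⟨p, ⟨hp, by simpa [hTp] using hL⟩, by simp [hTp]⟩
  · rintro ⟨q, ⟨hq, hL⟩, rfl⟩
    exact ⟨Tk q, ⟨fun i => hT ▸ ⟨q i, hq i, rfl⟩, hL⟩, rfl⟩

/-- Sets that have a lift through some power of the three-dimensional second-order cone. -/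
def SOCRep (C : Set W) : Prop := ∃ k, HasConeLift socBase k C

lemma SOCRep.image {C : Set W} (h : SOCRep C) (f : W →ₗ[ℝ] W') : SOCRep (f '' C) := by
  obtain ⟨k, L, φ, rfl⟩ := h
  exact ⟨k, L, f ∘ₗ φ, by rw [LinearMap.coe_comp, Set.image_comp]⟩

lemma SOCRep.inter_submodule {C : Set W} (h : SOCRep C) (S : Submodule ℝ W) :
    SOCRep (C ∩ S) := by
  obtain ⟨k, L, φ, rfl⟩ := h
  refine ⟨k, L ⊓ S.comap φ, φ, ?_⟩
  ext w
  constructor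
  · rintro ⟨⟨q, ⟨hq, hL⟩, rfl⟩, hS⟩
    exact ⟨q, ⟨hq, hL, hS⟩, rfl⟩
  · rintro ⟨q, ⟨hq, hL, hS⟩, rfl⟩
    exact ⟨⟨q, ⟨hq, hL⟩, rfl⟩, hS⟩

lemma SOCRep.prod {C : Set W} {D : Set W'} (hC : SOCRep C) (hD : SOCRep D) :
    SOCRep (C ×ˢ D) := by
  obtain ⟨k, L, φ, rfl⟩ := hC
  obtain ⟨l, M, ψ, rfl⟩ := hD
  let rl : (Fin k ⊕ Fin l → ℝ × ℝ × ℝ) →ₗ[ℝ] (Fin k → ℝ × ℝ × ℝ) :=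
    LinearMap.funLeft ℝ _ Sum.inl
  let rr : (Fin k ⊕ Fin l → ℝ × ℝ × ℝ) →ₗ[ℝ] (Fin l → ℝ × ℝ × ℝ) :=
    LinearMap.funLeft ℝ _ Sum.inr
  refine ⟨_, HasConeLift.of_fintype (L.comap rl ⊓ M.comap rr)
    ((φ ∘ₗ rl).prod (ψ ∘ₗ rr)) ?_⟩
  ext ⟨w, w'⟩
  constructor
  · rintro ⟨⟨q, ⟨hq, hL⟩, h1⟩, ⟨p, ⟨hp, hM⟩, h2⟩⟩
    refine ⟨Sum.elim q p, ⟨?_, hL, hM⟩, Prod.ext h1 h2⟩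
    rintro (i | i)
    · exact hq i
    · exact hp i
  · rintro ⟨q, ⟨hq, hL, hM⟩, h⟩
    simp only [Prod.ext_iff] at h
    exact ⟨⟨rl q, ⟨fun i => hq _, hL⟩, h.1⟩, ⟨rr q, ⟨fun i => hq _, hM⟩, h.2⟩⟩

lemma SOCRep.inter {C D : Set W} (hC : SOCRep C) (hD : SOCRep D) : SOCRep (C ∩ D) := by
  have := ((hC.prod hD).inter_submodule
    (LinearMap.ker (LinearMap.fst ℝ W W - LinearMap.snd ℝ W W))).image (LinearMap.fst ℝ W W)
  convert this using 1
  ext w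
  constructor
  · rintro ⟨h1, h2⟩
    exact ⟨(w, w), ⟨⟨h1, h2⟩, by simp⟩, rfl⟩
  · rintro ⟨⟨a, b⟩, ⟨⟨h1, h2⟩, h3⟩, rfl⟩
    have : a = b := by simpa [sub_eq_zero] using h3
    subst this
    exact ⟨h1, h2⟩

lemma SOCRep.add {C D : Set W} (hC : SOCRep C) (hD : SOCRep D) : SOCRep (C + D) := by
  have := (hC.prod hD).image (LinearMap.fst ℝ W W + LinearMap.snd ℝ W W)
  convert this using 1
  ext w
  simp [Set.mem_add, and_assoc]

lemma SOCRep.univ [FiniteDimensional ℝ W] : SOCRep (Set.univ : Set W) := by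
  let m := Module.finrank ℝ W
  let b : (Fin m → ℝ) ≃ₗ[ℝ] W := (Module.finBasis ℝ W).equivFun.symm
  have : SOCRep (Set.univ : Set (Fin m → ℝ)) := by
    refine ⟨m, ⊤, LinearMap.compLeft (LinearMap.snd ℝ ℝ ℝ ∘ₗ LinearMap.snd ℝ ℝ (ℝ × ℝ)) _, ?_⟩
    symm
    rw [Set.eq_univ_iff_forall]
    intro x
    -- Any real number is the off-diagonal entry of a positive semidefinite matrix.
    exact ⟨fun i => (x i ^ 2, 1, x i), ⟨fun i => by simp [socBase, sq_nonneg], trivial⟩, rfl⟩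
  have h := this.image b.toLinearMap
  rwa [Set.image_univ, LinearEquiv.coe_coe, b.surjective.range_eq] at h

lemma SOCRep.preimage [FiniteDimensional ℝ W] {D : Set W'} (hD : SOCRep D) (f : W →ₗ[ℝ] W') :
    SOCRep {w | f w ∈ D} := by
  have := (((SOCRep.univ (W := W)).prod hD).inter_submodule
    (LinearMap.ker (f ∘ₗ LinearMap.fst ℝ W W' - LinearMap.snd ℝ W W'))).image
      (LinearMap.fst ℝ W W')
  convert this using 1
  ext w
  constructor
  · intro h
    exact ⟨(w, f w), ⟨⟨trivial, h⟩, by simp⟩, rfl⟩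
  · rintro ⟨⟨a, b⟩, ⟨⟨-, h2⟩, h3⟩, rfl⟩
    have : f a = b := by simpa [sub_eq_zero] using h3
    subst this
    exact h2

lemma SOCRep.forall_mem [FiniteDimensional ℝ W] {ι : Type*} (s : Finset ι) {C : ι → Set W}
    (h : ∀ i ∈ s, SOCRep (C i)) : SOCRep {w | ∀ i ∈ s, w ∈ C i} := by
  classical
  induction s using Finset.induction_on with
  | empty => simpa using SOCRep.univ
  | insert a s ha ih =>
    have := (h a (by simp)).inter (ih fun i hi => h i (by simp [hi]))
    convert this using 1
    ext w
    simp

lemma SOCRep.exists_prod [FiniteDimensional ℝ W] {C : Set (W × W')} (h : SOCRep C) :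
    SOCRep {w | ∃ z, (w, z) ∈ C} := by
  convert h.image (LinearMap.fst ℝ W W') using 1
  ext w
  simp

lemma socRep_zero : SOCRep ({0} : Set W) :=
  ⟨0, ⊤, 0, by ext; simp⟩

lemma SOCRep.finset_sum {ι : Type*} (s : Finset ι) {C : ι → Set W}
    (h : ∀ i ∈ s, SOCRep (C i)) : SOCRep (∑ i ∈ s, C i) := by
  classical
  induction s using Finset.induction_on with
  | empty => exact socRep_zero
  | insert a s ha ih =>
    rw [Finset.sum_insert ha]
    exact (h a (by simp)).add (ih fun i hi => h i (by simp [hi]))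

lemma socRep_socBase : SOCRep socBase := by
  refine ⟨1, ⊤, LinearMap.proj 0, ?_⟩
  ext w
  constructor
  · intro h
    exact ⟨fun _ => w, ⟨fun _ => h, trivial⟩, rfl⟩
  · rintro ⟨q, ⟨hq, -⟩, rfl⟩
    exact hq 0

lemma socRep_nonneg [FiniteDimensional ℝ W] (f : W →ₗ[ℝ] ℝ) : SOCRep {w | 0 ≤ f w} := by
  have : SOCRep (Set.Ici (0 : ℝ)) := by
    convert socRep_socBase.image (LinearMap.fst ℝ ℝ (ℝ × ℝ)) using 1
    ext t
    constructor
    · intro h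
      exact ⟨(t, 0, 0), by simpa [socBase] using h, rfl⟩
    · rintro ⟨p, hp, rfl⟩
      exact hp.1
  exact this.preimage f

lemma socRep_sq_le_mul [FiniteDimensional ℝ W] (f g h : W →ₗ[ℝ] ℝ) :
    SOCRep {w | 0 ≤ f w ∧ 0 ≤ g w ∧ h w ^ 2 ≤ f w * g w} :=
  socRep_socBase.preimage (f.prod (g.prod h))

lemma socBase_add_mem {p q : ℝ × ℝ × ℝ} (hp : p ∈ socBase) (hq : q ∈ socBase) :
    p + q ∈ socBase := by
  obtain ⟨a, b, c⟩ := p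
  obtain ⟨a', b', c'⟩ := q
  simp only [socBase, Set.mem_ofPred_eq, Prod.mk_add_mk] at *
  obtain ⟨ha, hb, hc⟩ := hp
  obtain ⟨ha', hb', hc'⟩ := hq
  refine ⟨by positivity, by positivity, ?_⟩
  -- The cross term `2 c c'` is controlled by the arithmetic-geometric mean inequality for `a b'`
  -- and `a' b`.
  have h1 : (c * c') ^ 2 ≤ (a * b') * (a' * b) := by
    calc (c * c') ^ 2 = c ^ 2 * c' ^ 2 := by ring
      _ ≤ (a * b) * (a' * b') := by gcongr
      _ = _ := by ring
  have h2 : 2 * (c * c') ≤ a * b' + a' * b := by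
    refine le_of_abs_le (abs_le_of_sq_le_sq ?_ (by positivity))
    nlinarith [sq_nonneg (a * b' - a' * b)]
  nlinarith

lemma socBase_smul_mem {p : ℝ × ℝ × ℝ} (hp : p ∈ socBase) {t : ℝ} (ht : 0 ≤ t) :
    t • p ∈ socBase := by
  obtain ⟨a, b, c⟩ := p
  simp only [socBase, Set.mem_ofPred_eq, Prod.smul_mk, smul_eq_mul] at *
  obtain ⟨ha, hb, hc⟩ := hp
  refine ⟨by positivity, by positivity, ?_⟩
  nlinarith [mul_le_mul_of_nonneg_left hc (sq_nonneg t)]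

/-- Together with the next two lemmas: a set with a lift is a convex cone, which is how the
decomposition arguments use representability. -/
lemma SOCRep.add_mem {C : Set W} (h : SOCRep C) {x y : W} (hx : x ∈ C) (hy : y ∈ C) :
    x + y ∈ C := by
  obtain ⟨k, L, φ, rfl⟩ := h
  obtain ⟨p, ⟨hp, hpL⟩, rfl⟩ := hx
  obtain ⟨q, ⟨hq, hqL⟩, rfl⟩ := hy
  exact ⟨p + q, ⟨fun i => socBase_add_mem (hp i) (hq i), L.add_mem hpL hqL⟩, map_add _ _ _⟩

lemma SOCRep.smul_mem {C : Set W} (h : SOCRep C) {x : W} (hx : x ∈ C) {t : ℝ} (ht : 0 ≤ t) :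
    t • x ∈ C := by
  obtain ⟨k, L, φ, rfl⟩ := h
  obtain ⟨p, ⟨hp, hpL⟩, rfl⟩ := hx
  exact ⟨t • p, ⟨fun i => socBase_smul_mem (hp i) ht, L.smul_mem t hpL⟩, map_smul _ _ _⟩

lemma SOCRep.zero_mem {C : Set W} (h : SOCRep C) : (0 : W) ∈ C := by
  obtain ⟨k, L, φ, rfl⟩ := h
  exact ⟨0, ⟨fun i => by simp [socBase], L.zero_mem⟩, map_zero _⟩

lemma SOCRep.sum_mem {C : Set W} (h : SOCRep C) {ι : Type*} {s : Finset ι} {x : ι → W}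
    (hx : ∀ i ∈ s, x i ∈ C) : ∑ i ∈ s, x i ∈ C :=
  Finset.sum_induction x (· ∈ C) (fun _ _ => h.add_mem) h.zero_mem hx

lemma HasConeLift.psdTwo {k : ℕ} {C : Set W} (h : HasConeLift socBase k C) :
    HasConeLift psdTwo k C := by
  let T : Matrix (Fin 2) (Fin 2) ℝ →ₗ[ℝ] ℝ × ℝ × ℝ :=
    (Matrix.entryLinearMap ℝ ℝ 0 0).prod
      ((Matrix.entryLinearMap ℝ ℝ 1 1).prod (Matrix.entryLinearMap ℝ ℝ 0 1))
  have hT : ∀ M, T M = (M 0 0, M 1 1, M 0 1) := fun M => rfl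
  refine h.of_image T ?_
  ext ⟨a, b, c⟩
  constructor
  · rintro ⟨M, hM, hMe⟩
    have hM' : M.PosSemidef := hM
    rw [hT] at hMe
    simp only [Prod.mk.injEq] at hMe
    obtain ⟨rfl, rfl, rfl⟩ := hMe
    refine ⟨hM'.diag_nonneg, hM'.diag_nonneg, ?_⟩
    have hdet := hM'.det_nonneg
    have hs : M 1 0 = M 0 1 := by simpa using hM'.1.apply 0 1
    rw [Matrix.det_fin_two, hs] at hdet
    simp only
    linarith [sq (M 0 1)]
  · rintro ⟨ha, hb, hc⟩
    simp only at ha hb hc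
    refine ⟨!![a, c; c, b], ?_, by simp [hT]⟩
    refine Matrix.PosSemidef.of_dotProduct_mulVec_nonneg ?_ ?_
    · ext i j
      fin_cases i <;> fin_cases j <;> simp
    · intro x
      have h1 : |2 * c * x 0 * x 1| ≤ a * x 0 ^ 2 + b * x 1 ^ 2 := by
        refine abs_le_of_sq_le_sq ?_ (by positivity)
        have := mul_le_mul_of_nonneg_right hc (sq_nonneg (x 0 * x 1))
        nlinarith [sq_nonneg (a * x 0 ^ 2 - b * x 1 ^ 2)]
      have h2 := (abs_le.1 h1).1
      simp only [star_trivial, dotProduct, Matrix.mulVec, Fin.sum_univ_two, Matrix.of_apply,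
        Matrix.cons_val', Matrix.cons_val_zero, Matrix.cons_val_one, Matrix.cons_val_fin_one]
      nlinarith

lemma HasConeLift.rotatedSOC {k : ℕ} {C : Set W} (h : HasConeLift socBase k C) :
    HasConeLift (rotatedSOC 1) k C := by
  -- Doubling the first coordinate absorbs the factor in `2 a₁ a₂ ≥ a₃²`.
  let T : (Fin (1 + 2) → ℝ) →ₗ[ℝ] ℝ × ℝ × ℝ :=
    ((2 : ℝ) • LinearMap.proj 0).prod ((LinearMap.proj 1).prod (LinearMap.proj 2))
  have hT : ∀ q, T q = (2 * q 0, q 1, q 2) := fun q => rfl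
  refine h.of_image T ?_
  ext ⟨a, b, c⟩
  constructor
  · rintro ⟨q, ⟨h1, h2, h3⟩, he⟩
    rw [hT] at he
    simp only [Prod.mk.injEq] at he
    obtain ⟨rfl, rfl, rfl⟩ := he
    simp at h1
    exact ⟨by simpa using h2, h3, by simpa using h1⟩
  · rintro ⟨ha, hb, hc⟩
    simp only at ha hb hc
    refine ⟨![a / 2, b, c], ⟨?_, ?_, hb⟩, ?_⟩
    · simp
      linarith
    · simp
      linarith
    · simp [hT]
      ring

end ConeLift

/-! ### Geometric mean inequalities. -/

/-- A binary tree: the factors are halved, each half bounds an auxiliary `zᵢ ^ 2 ^ l`, and the root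
is the constraint `g² ≤ z₁ z₂`. Taking `zᵢ` to be the exact root of its half product shows that
nothing is lost. -/
lemma socRep_two_pow_le_prod : ∀ (l : ℕ) {W : Type*} [AddCommGroup W] [Module ℝ W]
    [FiniteDimensional ℝ W] (s : Multiset (W →ₗ[ℝ] ℝ)) (g : W →ₗ[ℝ] ℝ)
    (_ : Multiset.card s = 2 ^ l),
    SOCRep {w | (∀ f ∈ s, 0 ≤ f w) ∧ 0 ≤ g w ∧ g w ^ 2 ^ l ≤ (s.map fun f => f w).prod}
  | 0, W, _, _, _, s, g, hs => by
    obtain ⟨f, rfl⟩ := Multiset.card_eq_one.1 (by simpa using hs)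
    convert (socRep_nonneg g).inter (socRep_nonneg (f - g)) using 1
    ext w
    simp only [Multiset.mem_singleton, forall_eq, pow_zero, pow_one, Multiset.map_singleton,
      Multiset.prod_singleton, Set.mem_ofPred_eq, Set.mem_inter_iff, LinearMap.sub_apply,
      sub_nonneg]
    exact ⟨fun h => h.2, fun h => ⟨h.1.trans h.2, h⟩⟩
  | l + 1, W, _, _, _, s, g, hs => by
    obtain ⟨s₁, s₂, rfl, h₁, h₂⟩ : ∃ s₁ s₂ : Multiset (W →ₗ[ℝ] ℝ), s = s₁ + s₂ ∧
        Multiset.card s₁ = 2 ^ l ∧ Multiset.card s₂ = 2 ^ l := by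
      obtain ⟨L, rfl⟩ := Quot.exists_rep s
      have hL : L.length = 2 ^ (l + 1) := hs
      refine ⟨(L.take (2 ^ l) : List _), (L.drop (2 ^ l) : List _), ?_, ?_, ?_⟩
      · rw [Multiset.coe_add, List.take_append_drop]
        rfl
      · simp [hL, pow_succ]
      · simp [hL, pow_succ]
        omega
    let P := LinearMap.fst ℝ W (ℝ × ℝ)
    let Z₁ := LinearMap.fst ℝ ℝ ℝ ∘ₗ LinearMap.snd ℝ W (ℝ × ℝ)
    let Z₂ := LinearMap.snd ℝ ℝ ℝ ∘ₗ LinearMap.snd ℝ W (ℝ × ℝ)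
    have r₁ := socRep_two_pow_le_prod l (s₁.map fun f => f ∘ₗ P) Z₁ (by simpa using h₁)
    have r₂ := socRep_two_pow_le_prod l (s₂.map fun f => f ∘ₗ P) Z₂ (by simpa using h₂)
    have r₃ := socRep_sq_le_mul Z₁ Z₂ (g ∘ₗ P)
    have r₄ := socRep_nonneg (g ∘ₗ P)
    convert (((r₁.inter r₂).inter r₃).inter r₄).exists_prod using 1
    ext w
    simp only [Multiset.mem_add, Multiset.map_add, Multiset.prod_add, Set.mem_ofPred_eq,
      Multiset.mem_map, forall_exists_index, and_imp, forall_apply_eq_imp_iff₂,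
      LinearMap.comp_apply, Multiset.map_map, Function.comp_apply, P, Z₁, Z₂,
      LinearMap.fst_apply, LinearMap.snd_apply, Set.mem_inter_iff, Prod.exists]
    have hroot : ∀ x : ℝ, 0 ≤ x → ∃ z : ℝ, 0 ≤ z ∧ z ^ 2 ^ l = x := fun x hx =>
      ⟨x ^ ((2 ^ l : ℕ) : ℝ)⁻¹, Real.rpow_nonneg hx _,
        Real.rpow_inv_natCast_pow hx (by positivity)⟩
    constructor
    · rintro ⟨hf, hg, hle⟩
      obtain ⟨z₁, hz₁, e₁⟩ := hroot (s₁.map fun f => f w).prod (Multiset.prod_nonneg (by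
        simp only [Multiset.mem_map, forall_exists_index, and_imp, forall_apply_eq_imp_iff₂]
        exact fun f h => hf f (Or.inl h)))
      obtain ⟨z₂, hz₂, e₂⟩ := hroot (s₂.map fun f => f w).prod (Multiset.prod_nonneg (by
        simp only [Multiset.mem_map, forall_exists_index, and_imp, forall_apply_eq_imp_iff₂]
        exact fun f h => hf f (Or.inr h)))
      refine ⟨z₁, z₂, ⟨⟨⟨fun f h => hf f (Or.inl h), hz₁, e₁.le⟩,
        ⟨fun f h => hf f (Or.inr h), hz₂, e₂.le⟩⟩, hz₁, hz₂, ?_⟩, hg⟩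
      rw [← e₁, ← e₂, ← mul_pow, pow_succ', pow_mul] at hle
      exact (pow_le_pow_iff_left₀ (by positivity) (by positivity) (by positivity)).1 hle
    · rintro ⟨z₁, z₂, ⟨⟨⟨hf₁, hz₁, e₁⟩, ⟨hf₂, hz₂, e₂⟩⟩, -, -, h⟩, hg⟩
      refine ⟨fun f hf => hf.elim (hf₁ f) (hf₂ f), hg, ?_⟩
      calc g w ^ 2 ^ (l + 1) = (g w ^ 2) ^ 2 ^ l := by rw [pow_succ', pow_mul]
        _ ≤ (z₁ * z₂) ^ 2 ^ l := by gcongr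
        _ = z₁ ^ 2 ^ l * z₂ ^ 2 ^ l := mul_pow _ _ _
        _ ≤ _ := by
          refine mul_le_mul e₁ e₂ (by positivity) ((pow_nonneg hz₁ _).trans e₁)

/-- The weighted geometric mean cone with natural exponents is second-order cone representable. -/
lemma socRep_abs_pow_le_prod {W : Type*} [AddCommGroup W] [Module ℝ W]
    [FiniteDimensional ℝ W] {ι : Type*} (T : Finset ι) (p : ι → ℕ) (q : ℕ) (hq : 0 < q)
    (hp : ∑ i ∈ T, p i = q) (c : ι → W →ₗ[ℝ] ℝ) (d : W →ₗ[ℝ] ℝ) :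
    SOCRep {w | (∀ i ∈ T, 0 ≤ c i w) ∧ |d w| ^ q ≤ ∏ i ∈ T, c i w ^ p i} := by
  let P := LinearMap.fst ℝ W ℝ
  let t := LinearMap.snd ℝ W ℝ
  have hqq : q ≤ 2 ^ q := Nat.lt_two_pow_self.le
  -- With `t ≥ |d|`, the bound `t ^ q ≤ ∏` is multiplied by `t ^ (2 ^ q - q)`, which brings the
  -- number of factors to a power of two.
  have r₁ := socRep_two_pow_le_prod q
    (∑ i ∈ T, Multiset.replicate (p i) (c i ∘ₗ P) + Multiset.replicate (2 ^ q - q) t) t (by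
      simp [hp]; omega)
  have r₂ := SOCRep.forall_mem T (C := fun i => {w : W × ℝ | 0 ≤ (c i ∘ₗ P) w})
    fun i _ => socRep_nonneg _
  have r₃ := socRep_nonneg (t - d ∘ₗ P)
  have r₄ := socRep_nonneg (t + d ∘ₗ P)
  convert (((r₁.inter r₂).inter r₃).inter r₄).exists_prod using 1
  ext w
  have hprod : ∀ z : ℝ, (Multiset.map (fun f : W × ℝ →ₗ[ℝ] ℝ => f (w, z))
      (∑ i ∈ T, Multiset.replicate (p i) (c i ∘ₗ P) +
        Multiset.replicate (2 ^ q - q) t)).prod =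
      (∏ i ∈ T, c i w ^ p i) * z ^ (2 ^ q - q) := by
    intro z
    rw [Multiset.map_add, Multiset.prod_add, ← Multiset.coe_mapAddMonoidHom, map_sum,
      Multiset.prod_sum]
    simp [P, t]
  simp only [Set.mem_ofPred_eq, Set.mem_inter_iff, hprod]
  simp only [P, t, LinearMap.comp_apply, LinearMap.fst_apply, LinearMap.snd_apply,
    LinearMap.sub_apply, LinearMap.add_apply, sub_nonneg]
  constructor
  · rintro ⟨hc, hd⟩
    refine ⟨|d w|, ⟨⟨⟨?_, abs_nonneg _, ?_⟩, hc⟩, le_abs_self _⟩, ?_⟩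
    · intro f hf
      rw [Multiset.mem_add] at hf
      rcases hf with hf | hf
      · rw [Multiset.mem_sum] at hf
        obtain ⟨i, hi, hf⟩ := hf
        rw [Multiset.eq_of_mem_replicate hf]
        exact hc i hi
      · rw [Multiset.eq_of_mem_replicate hf]
        exact abs_nonneg _
    · calc |d w| ^ 2 ^ q = |d w| ^ q * |d w| ^ (2 ^ q - q) := by
            rw [← pow_add, Nat.add_sub_cancel' hqq]
        _ ≤ _ := by gcongr
    · linarith [neg_abs_le (d w)]
  · rintro ⟨z, ⟨⟨⟨-, hz, hle⟩, hc⟩, h1⟩, h2⟩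
    refine ⟨hc, ?_⟩
    have hdz : |d w| ≤ z := abs_le.2 ⟨by linarith, h1⟩
    refine (pow_le_pow_left₀ (abs_nonneg _) hdz q).trans ?_
    -- The padding can be cancelled only for `z > 0`; at `z = 0` the bound is trivial.
    rcases hz.eq_or_lt with rfl | hz
    · rw [zero_pow hq.ne']
      exact Finset.prod_nonneg fun i hi => pow_nonneg (hc i hi) _
    · rw [← Nat.add_sub_cancel' hqq, pow_add, Nat.add_sub_cancel_left] at hle
      exact le_of_mul_le_mul_right hle (by positivity)

/-! ### Circuit cones: rational weights, representability, nonnegativity. -/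

section Circuit

variable {n : ℕ}

lemma eval_monomial_fin (x : Fin n → ℝ) (α : Fin n →₀ ℕ) (c : ℝ) :
    eval x (monomial α c) = c * ∏ i, x i ^ α i := by
  rw [eval_monomial, Finsupp.prod_fintype _ _ (by simp)]

/-- The weights of a convex combination `β` of the points of `T`. -/
structure IsConvexWeight (T : Finset (Fin n →₀ ℕ)) (β : Fin n →₀ ℕ)
    (w : (Fin n →₀ ℕ) → ℝ) : Prop where
  nonneg : ∀ α ∈ T, 0 ≤ w α
  sum_eq_one : ∑ α ∈ T, w α = 1
  sum_smul : ∑ α ∈ T, w α • toRealPt α = toRealPt β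

lemma IsConvexWeight.sum_mul {T : Finset (Fin n →₀ ℕ)} {β : Fin n →₀ ℕ}
    {w : (Fin n →₀ ℕ) → ℝ} (h : IsConvexWeight T β w) (i : Fin n) :
    ∑ α ∈ T, w α * α i = β i := by
  simpa [toRealPt] using congrFun h.sum_smul i

lemma InSimplexInterior.weight_unique {T : Finset (Fin n →₀ ℕ)} {β : Fin n →₀ ℕ}
    (hT : InSimplexInterior T β) {w w' : (Fin n →₀ ℕ) → ℝ} (h : ∑ α ∈ T, w α = 1)
    (hs : ∑ α ∈ T, w α • toRealPt α = toRealPt β) (h' : ∑ α ∈ T, w' α = 1)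
    (hs' : ∑ α ∈ T, w' α • toRealPt α = toRealPt β) : ∀ α ∈ T, w α = w' α := by
  intro α hα
  have := hT.1.eq_of_sum_eq_sum (s := Finset.univ) (w₁ := fun a : T => w a)
    (w₂ := fun a : T => w' a)
    (by rw [Finset.sum_coe_sort T w, Finset.sum_coe_sort T w', h, h'])
    (by
      rw [Finset.sum_coe_sort T fun a => w a • toRealPt a,
        Finset.sum_coe_sort T fun a => w' a • toRealPt a, hs, hs'])
  exact this ⟨α, hα⟩ (Finset.mem_univ _)

/-- The barycentric coordinates of a lattice point in a lattice simplex are rational. -/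
lemma InSimplexInterior.exists_rational {T : Finset (Fin n →₀ ℕ)} {β : Fin n →₀ ℕ}
    (hT : InSimplexInterior T β) :
    ∃ (p : (Fin n →₀ ℕ) → ℕ) (q : ℕ), 0 < q ∧ ∑ α ∈ T, p α = q ∧
      (∀ α ∈ T, (0 : ℝ) < p α / q) ∧
      ∀ w : (Fin n →₀ ℕ) → ℝ, ∑ α ∈ T, w α = 1 →
        ∑ α ∈ T, w α • toRealPt α = toRealPt β → ∀ α ∈ T, w α = p α / q := by
  obtain ⟨w, hw, hw1, hws⟩ := hT.2
  -- A `ℚ`-linear retraction of `ℝ` onto `ℚ` sends the real solution of a linear system with integer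
  -- data to a rational one; by uniqueness the two agree.
  obtain ⟨φ, hφ⟩ := LinearMap.exists_leftInverse_of_injective (Algebra.linearMap ℚ ℝ)
    (LinearMap.ker_eq_bot.2 (algebraMap ℚ ℝ).injective)
  have hφq : ∀ r : ℚ, φ (r : ℝ) = r := fun r => by
    have := LinearMap.congr_fun hφ r
    simpa using this
  have hφ1 : φ 1 = 1 := by simpa using hφq 1
  have hr1 : ∑ α ∈ T, ((φ (w α) : ℚ) : ℝ) = 1 := by
    rw [← Rat.cast_sum, ← map_sum, hw1, hφ1, Rat.cast_one]
  have hrs : ∑ α ∈ T, ((φ (w α) : ℚ) : ℝ) • toRealPt α = toRealPt β := by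
    ext i
    have h1 : ∑ α ∈ T, w α * α i = β i := by simpa [toRealPt] using congrFun hws i
    have h2 : ∑ α ∈ T, φ (w α) * α i = (β i : ℚ) := by
      have := congrArg φ h1
      rw [map_sum] at this
      have h3 : φ (β i : ℝ) = β i := by simpa using hφq (β i)
      rw [h3] at this
      rw [← this]
      refine Finset.sum_congr rfl fun α _ => ?_
      have : w α * (α i : ℝ) = (α i : ℚ) • w α := by
        rw [Rat.smul_def]; push_cast; ring
      rw [this, map_smul, smul_eq_mul, mul_comm]
    simp only [Finset.sum_apply, Pi.smul_apply, toRealPt, smul_eq_mul]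
    exact_mod_cast h2
  have heq := hT.weight_unique hw1 hws hr1 hrs
  have hpos : ∀ α ∈ T, 0 < φ (w α) := fun α hα => by
    have := hw α hα
    rw [heq α hα] at this
    exact_mod_cast this
  -- The product of the denominators is a common denominator.
  let q : ℕ := ∏ α ∈ T, (φ (w α)).den
  have hq : 0 < q := Finset.prod_pos fun α _ => (φ (w α)).den_pos
  have hp : ∀ α, ∃ p : ℕ, α ∈ T → (φ (w α)) * q = p := by
    intro α
    by_cases hα : α ∈ T
    · obtain ⟨m, hm⟩ : (φ (w α)).den ∣ q := Finset.dvd_prod_of_mem _ hα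
      refine ⟨(φ (w α)).num.toNat * m, fun _ => ?_⟩
      have hnum : (((φ (w α)).num.toNat : ℤ) : ℚ) = (φ (w α)).num := by
        rw [Int.toNat_of_nonneg (Rat.num_nonneg.2 (hpos α hα).le)]
      have hnum' : (((φ (w α)).num.toNat : ℕ) : ℚ) = (φ (w α)).num := by
        rw [← hnum, Int.cast_natCast]
      rw [hm]
      push_cast
      rw [hnum', ← mul_assoc, Rat.mul_den_eq_num]
    · exact ⟨0, fun h => absurd h hα⟩
  choose p hp using hp
  have hpq : ∀ α ∈ T, ((φ (w α) : ℚ) : ℝ) = p α / q := fun α hα => by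
    rw [eq_div_iff (by positivity)]
    exact_mod_cast hp α hα
  refine ⟨p, q, hq, ?_, ?_, ?_⟩
  · have : ∑ α ∈ T, (p α : ℝ) / q = 1 := by
      rw [← hr1]
      exact Finset.sum_congr rfl fun α hα => (hpq α hα).symm
    rw [← Finset.sum_div, div_eq_one_iff_eq (by positivity)] at this
    exact_mod_cast this
  · intro α hα
    rw [← hpq α hα]
    exact_mod_cast hpos α hα
  · intro v hv1 hvs α hα
    rw [← hpq α hα]
    exact hT.weight_unique hv1 hvs hr1 hrs α hα

/-- The polynomials `∑_{α ∈ T} c_α x^α - d x^β` with `c ≥ 0` that satisfy the circuit number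
inequality `|d| ≤ ∏ (c_α / w_α) ^ w_α`, where `w` are positive barycentric coordinates of `β`. -/
def circuitCone (T : Finset (Fin n →₀ ℕ)) (β : Fin n →₀ ℕ) : Set (MvPolynomial (Fin n) ℝ) :=
  {f | ∃ (w c : (Fin n →₀ ℕ) → ℝ) (d : ℝ), IsConvexWeight T β w ∧ (∀ α ∈ T, 0 < w α) ∧
    (∀ α ∈ T, 0 ≤ c α) ∧ |d| ≤ ∏ α ∈ T, (c α / w α) ^ w α ∧
    f = ∑ α ∈ T, monomial α (c α) - monomial β d}

lemma abs_le_prod_rpow_iff {ι : Type*} (T : Finset ι) (p : ι → ℕ) {q : ℕ} (hq : 0 < q)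
    {c : ι → ℝ} (hc : ∀ i ∈ T, 0 ≤ c i) (d : ℝ) :
    |d| ≤ ∏ i ∈ T, c i ^ ((p i : ℝ) / q) ↔ |d| ^ q ≤ ∏ i ∈ T, c i ^ p i := by
  have h0 : 0 ≤ ∏ i ∈ T, c i ^ ((p i : ℝ) / q) :=
    Finset.prod_nonneg fun i hi => Real.rpow_nonneg (hc i hi) _
  have h1 : (∏ i ∈ T, c i ^ ((p i : ℝ) / q)) ^ q = ∏ i ∈ T, c i ^ p i := by
    rw [← Finset.prod_pow]
    refine Finset.prod_congr rfl fun i hi => ?_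
    rw [← Real.rpow_natCast, ← Real.rpow_mul (hc i hi), div_mul_cancel₀ _ (by positivity),
      Real.rpow_natCast]
  rw [← h1, pow_le_pow_iff_left₀ (abs_nonneg _) h0 hq.ne']

/-- The weights are forced to be `p α / q`, so raising the bound to the power `q` leaves integer
exponents. -/
lemma socRep_circuitCone {T : Finset (Fin n →₀ ℕ)} {β : Fin n →₀ ℕ}
    (hT : InSimplexInterior T β) : SOCRep (circuitCone T β) := by
  obtain ⟨p, q, hq, hpq, hpos, huniq⟩ := hT.exists_rational
  let cf : T → ((T → ℝ) × ℝ →ₗ[ℝ] ℝ) := fun α =>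
    ((p α : ℝ) / q)⁻¹ • (LinearMap.proj α ∘ₗ LinearMap.fst ℝ (T → ℝ) ℝ)
  have hcf : ∀ α w, cf α w = w.1 α / ((p α : ℝ) / q) := fun α w => by
    simp only [cf, LinearMap.smul_apply, LinearMap.comp_apply, LinearMap.proj_apply,
      LinearMap.fst_apply, smul_eq_mul]
    rw [mul_comm, div_eq_mul_inv (w.1 α)]
  have r := socRep_abs_pow_le_prod (Finset.univ : Finset T) (fun α => p α) q hq
    (by rw [Finset.sum_coe_sort T p, hpq]) cf (LinearMap.snd ℝ (T → ℝ) ℝ)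
  let Φ : (T → ℝ) × ℝ →ₗ[ℝ] MvPolynomial (Fin n) ℝ :=
    ∑ α : T, (monomial (R := ℝ) (α : Fin n →₀ ℕ)) ∘ₗ LinearMap.proj α ∘ₗ
      LinearMap.fst ℝ (T → ℝ) ℝ - (monomial (R := ℝ) β) ∘ₗ LinearMap.snd ℝ (T → ℝ) ℝ
  have hΦ : ∀ w, Φ w = ∑ α : T, monomial (α : Fin n →₀ ℕ) (w.1 α) - monomial β w.2 := by
    intro w
    simp [Φ]
  convert r.image Φ using 1
  ext f
  constructor
  · rintro ⟨w, c, d, hw, hwpos, hc, hd, rfl⟩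
    have hwe := huniq w hw.sum_eq_one hw.sum_smul
    refine ⟨(fun α => c α, d), ⟨fun α _ => ?_, ?_⟩, ?_⟩
    · rw [hcf]
      exact div_nonneg (hc α α.2) (hpos α α.2).le
    · simp only [hcf, LinearMap.snd_apply]
      rw [Finset.prod_coe_sort T fun α => (c α / ((p α : ℝ) / q)) ^ p α,
        ← abs_le_prod_rpow_iff T p hq fun α hα => div_nonneg (hc α hα) (hpos α hα).le]
      refine hd.trans_eq (Finset.prod_congr rfl fun α hα => ?_)
      rw [hwe α hα]
    · rw [hΦ]
      simp only
      rw [Finset.sum_coe_sort T fun α => monomial α (c α)]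
  · rintro ⟨⟨c, d⟩, ⟨hc, hd⟩, rfl⟩
    simp only [hcf, LinearMap.snd_apply] at hc hd
    obtain ⟨w, hw, hw1, hws⟩ := hT.2
    have hwe := huniq w hw1 hws
    let c' : (Fin n →₀ ℕ) → ℝ := fun α => if h : α ∈ T then c ⟨α, h⟩ else 0
    have hc' : ∀ α : T, c' α = c α := fun α => by simp [c']
    have hnn : ∀ α ∈ T, 0 ≤ c' α / ((p α : ℝ) / q) := fun α hα => by
      simpa [hc' ⟨α, hα⟩] using hc ⟨α, hα⟩ (Finset.mem_univ _)
    refine ⟨w, c', d, ⟨fun α hα => (hw α hα).le, hw1, hws⟩, hw, fun α hα => ?_, ?_, ?_⟩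
    · have := mul_nonneg (hnn α hα) (hpos α hα).le
      rwa [div_mul_cancel₀ _ (hpos α hα).ne'] at this
    · simp only [← hc'] at hd
      rw [Finset.prod_coe_sort T fun α => (c' α / ((p α : ℝ) / q)) ^ p α,
        ← abs_le_prod_rpow_iff T p hq hnn] at hd
      refine hd.trans_eq (Finset.prod_congr rfl fun α hα => ?_)
      rw [hwe α hα]
    · rw [hΦ]
      simp only [← hc']
      rw [Finset.sum_coe_sort T fun α => monomial α (c' α)]

lemma IsEvenPt.prod_pow_eq_abs {α : Fin n →₀ ℕ} (hα : IsEvenPt α) (x : Fin n → ℝ) :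
    ∏ i, x i ^ α i = ∏ i, |x i| ^ α i :=
  Finset.prod_congr rfl fun i _ => ((hα i).pow_abs (x i)).symm

lemma IsConvexWeight.prod_rpow {T : Finset (Fin n →₀ ℕ)} {β : Fin n →₀ ℕ}
    {w : (Fin n →₀ ℕ) → ℝ} (hw : IsConvexWeight T β w) (x : Fin n → ℝ) (hx : ∀ i, 0 ≤ x i) :
    ∏ α ∈ T, (∏ i, x i ^ α i) ^ w α = ∏ i, x i ^ β i := by
  calc ∏ α ∈ T, (∏ i, x i ^ α i) ^ w α = ∏ α ∈ T, ∏ i, x i ^ (w α * α i) := by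
        refine Finset.prod_congr rfl fun α _ => ?_
        rw [← Real.finsetProd_rpow _ _ fun i _ => pow_nonneg (hx i) _]
        refine Finset.prod_congr rfl fun i _ => ?_
        rw [← Real.rpow_natCast, ← Real.rpow_mul (hx i), mul_comm]
    _ = ∏ i, ∏ α ∈ T, x i ^ (w α * α i) := Finset.prod_comm
    _ = ∏ i, x i ^ β i := by
        refine Finset.prod_congr rfl fun i _ => ?_
        rw [← Real.rpow_sum_of_nonneg (hx i) fun α hα =>
          mul_nonneg (hw.nonneg α hα) (Nat.cast_nonneg _), hw.sum_mul, Real.rpow_natCast]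

lemma monomial_mem_SONC {α : Fin n →₀ ℕ} (hα : IsEvenPt α) {c : ℝ} (hc : 0 ≤ c) :
    monomial α c ∈ SONC n :=
  AddSubmonoid.subset_closure (Or.inr ⟨α, c, hα, hc, rfl⟩)

/-- Weighted arithmetic-geometric mean inequality, applied at the absolute values of the
coordinates. -/
lemma circuitCone_subset_SONC {T : Finset (Fin n →₀ ℕ)} {β : Fin n →₀ ℕ}
    (hT : InSimplexInterior T β) (heven : ∀ α ∈ T, IsEvenPt α) {f : MvPolynomial (Fin n) ℝ}
    (hf : f ∈ circuitCone T β) : f ∈ SONC n := by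
  obtain ⟨w, c, d, hw, hwpos, hc, hd, rfl⟩ := hf
  by_cases h : ∀ α ∈ T, 0 < c α
  · refine AddSubmonoid.subset_closure (Or.inl ⟨⟨T, β, c, d, heven, h, hT, rfl⟩, fun x => ?_⟩)
    simp only [map_sub, map_sum, eval_monomial_fin, sub_nonneg]
    calc d * ∏ i, x i ^ β i ≤ |d| * ∏ i, |x i| ^ β i := by
          refine (le_abs_self _).trans_eq ?_
          rw [abs_mul, Finset.abs_prod]
          simp
      _ ≤ (∏ α ∈ T, (c α / w α) ^ w α) * ∏ i, |x i| ^ β i := by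
          gcongr
      _ = ∏ α ∈ T, (c α / w α * ∏ i, |x i| ^ α i) ^ w α := by
          rw [← hw.prod_rpow _ fun i => abs_nonneg _, ← Finset.prod_mul_distrib]
          refine Finset.prod_congr rfl fun α hα => (Real.mul_rpow ?_ ?_).symm
          · exact div_nonneg (hc α hα) (hwpos α hα).le
          · positivity
      _ ≤ ∑ α ∈ T, w α * (c α / w α * ∏ i, |x i| ^ α i) := by
          refine Real.geom_mean_le_arith_mean_weighted _ _ _ hw.nonneg hw.sum_eq_one ?_
          intro α hα
          exact mul_nonneg (div_nonneg (hc α hα) (hwpos α hα).le) (by positivity)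
      _ = ∑ α ∈ T, c α * ∏ i, x i ^ α i := by
          refine Finset.sum_congr rfl fun α hα => ?_
          rw [(heven α hα).prod_pow_eq_abs x, ← mul_assoc, mul_div_cancel₀ _ (hwpos α hα).ne']
  -- A vanishing outer coefficient is not allowed in a circuit polynomial, but it makes the product
  -- zero. Then `d = 0` and only monomial squares remain.
  · push Not at h
    obtain ⟨α, hα, hle⟩ := h
    have h0 : c α = 0 := le_antisymm hle (hc α hα)
    have hd0 : d = 0 := by
      rw [Finset.prod_eq_zero hα (by rw [h0, zero_div, Real.zero_rpow (hwpos α hα).ne'])] at hd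
      exact abs_nonpos_iff.1 hd
    rw [hd0, map_zero, sub_zero]
    exact AddSubmonoid.sum_mem _ fun α hα => monomial_mem_SONC (heven α hα) (hc α hα)

end Circuit

/-! ### Entropy duality for sums of exponentials. -/

/-- Relative entropy duality: a lower bound on a positive sum of exponentials is certified by a
balanced probability vector. -/
lemma exists_entropy_dual {m : ℕ} {ι : Type*} [Fintype ι] (a : ι → Fin m → ℝ) (c : ι → ℝ)
    (hc : ∀ i, 0 < c i) {d : ℝ} (hd : 0 < d)
    (h : ∀ y : Fin m → ℝ, d ≤ ∑ i, c i * Real.exp (y ⬝ᵥ a i)) :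
    ∃ ν ∈ stdSimplex ℝ ι, ∑ i, ν i • a i = 0 ∧
      Real.log d ≤ ∑ i, (ν i * Real.log (c i) + Real.negMulLog (ν i)) := by
  classical
  have hne : Nonempty ι := by
    by_contra hι
    rw [not_nonempty_iff] at hι
    have := h 0
    simp at this
    linarith
  let H : (ι → ℝ) → ℝ := fun ν => ∑ i, (ν i * Real.log (c i) + Real.negMulLog (ν i))
  -- The Lagrangian, with `y` the multiplier of the balance condition: concave in `ν`, affine in
  -- `y`.
  let F : (ι → ℝ) → (Fin m → ℝ) → ℝ := fun ν y => ∑ i, ν i * (y ⬝ᵥ a i) + H ν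
  have hHcont : Continuous H := by
    refine continuous_finsetSum _ fun i _ => ?_
    exact ((continuous_apply i).mul continuous_const).add
      (Real.continuous_negMulLog.comp (continuous_apply i))
  have hFcont : ∀ y, Continuous fun ν => F ν y := fun y => by
    refine Continuous.add ?_ hHcont
    exact continuous_finsetSum _ fun i _ => (continuous_apply i).mul continuous_const
  have hFdot : ∀ ν y, F ν y = y ⬝ᵥ (∑ i, ν i • a i) + H ν := fun ν y => by
    simp [F, dotProduct_sum]
  by_contra hcon
  push Not at hcon
  have hlt : ∀ ν ∈ stdSimplex ℝ ι, ∃ y, F ν y < Real.log d := by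
    intro ν hν
    by_contra hle
    push Not at hle
    -- Otherwise a multiple of the nonzero barycentre, used as `y`, brings the Lagrangian to `log d
    -- - 1`.
    have hzero : ∑ i, ν i • a i = 0 := by
      by_contra hb
      set b := ∑ i, ν i • a i
      have hbb : 0 < b ⬝ᵥ b := by
        have := dotProduct_self_star_nonneg b
        rw [star_trivial] at this
        refine this.lt_of_ne fun h0 => hb (dotProduct_self_eq_zero.1 h0.symm)
      have := hle (((Real.log d - H ν - 1) / (b ⬝ᵥ b)) • b)
      rw [hFdot, smul_dotProduct, smul_eq_mul, div_mul_cancel₀ _ hbb.ne'] at this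
      linarith
    have h1 := hcon ν hν hzero
    have h2 := hle 0
    rw [hFdot, zero_dotProduct, zero_add] at h2
    exact absurd h2 (not_le.2 h1)
  choose! Y hY using hlt
  -- By compactness finitely many multipliers suffice, and the minimax theorem then merges them into
  -- a single `y` good for every `ν`.
  obtain ⟨s, hs, hcov⟩ := (isCompact_stdSimplex ℝ ι).elim_nhds_subcover
    (fun ν => {μ | F μ (Y ν) < Real.log d}) fun ν hν =>
      (isOpen_lt (hFcont _) continuous_const).mem_nhds (hY ν hν)
  have hconv : ∀ y, ConcaveOn ℝ (stdSimplex ℝ ι) fun ν => F ν y := by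
    intro y
    refine ⟨convex_stdSimplex ℝ ι, fun x hx z hz p q hp hq hpq => ?_⟩
    simp only [F, H, smul_eq_mul, mul_add, Finset.mul_sum, ← Finset.sum_add_distrib]
    refine Finset.sum_le_sum fun i _ => ?_
    have := Real.concaveOn_negMulLog.2 (hx.1 i) (hz.1 i) hp hq hpq
    simp only [smul_eq_mul] at this
    simp only [Pi.add_apply, Pi.smul_apply, smul_eq_mul]
    linarith
  obtain ⟨y, -, hy⟩ := Sion.exists_lt_iInf_of_lt_iInf_of_finite (X := stdSimplex ℝ ι)
    (Y := Set.univ) (f := fun ν y => -F ν y) (s := Y '' (s : Set (ι → ℝ))) (t := -Real.log d)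
    ⟨_, single_mem_stdSimplex ℝ hne.some⟩ (isCompact_stdSimplex ℝ ι)
    (fun y _ => (hFcont y).neg.lowerSemicontinuous.lowerSemicontinuousOn _)
    (fun y _ => (hconv y).neg.quasiconvexOn) convex_univ
    (fun ν _ => by
      have : Continuous (F ν) := by
        simp only [F]
        fun_prop
      exact this.neg.upperSemicontinuous.upperSemicontinuousOn _)
    (fun ν _ => by
      refine ConcaveOn.quasiconcaveOn ⟨convex_univ, fun x _ z _ p q _ _ hpq => le_of_eq ?_⟩
      simp only [hFdot, add_dotProduct, smul_dotProduct, smul_eq_mul]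
      linear_combination (-H ν) * hpq)
    (convex_stdSimplex ℝ ι) (s.finite_toSet.image Y) (Set.subset_univ _)
    (fun ν hν => by
      obtain ⟨μ, hμ, hμν⟩ := Set.mem_iUnion₂.1 (hcov hν)
      exact ⟨Y μ, ⟨μ, hμ, rfl⟩, neg_lt_neg hμν⟩)
  -- At the Gibbs distribution `e / Z` the Lagrangian equals `log Z ≥ log d`, a contradiction.
  let e : ι → ℝ := fun i => c i * Real.exp (y ⬝ᵥ a i)
  let Z := ∑ i, e i
  have he : ∀ i, 0 < e i := fun i => mul_pos (hc i) (Real.exp_pos _)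
  have hZ : 0 < Z := hd.trans_le (h y)
  have hg : (fun i => e i / Z) ∈ stdSimplex ℝ ι :=
    ⟨fun i => (div_pos (he i) hZ).le, by rw [← Finset.sum_div, div_self hZ.ne']⟩
  have hval : F (fun i => e i / Z) y = Real.log Z := by
    have : ∀ i, e i / Z * (y ⬝ᵥ a i) +
        (e i / Z * Real.log (c i) + Real.negMulLog (e i / Z)) = e i / Z * Real.log Z := by
      intro i
      rw [Real.negMulLog, Real.log_div (he i).ne' hZ.ne',
        Real.log_mul (hc i).ne' (Real.exp_ne_zero _), Real.log_exp]
      ring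
    simp only [F, H, ← Finset.sum_add_distrib, this]
    rw [← Finset.sum_mul, ← Finset.sum_div, div_self hZ.ne', one_mul]
  have h1 := neg_lt_neg_iff.1 (hy _ hg)
  rw [hval] at h1
  exact absurd (Real.log_le_log hd (h y)) (not_le.2 h1)

/-- The ratio test: the exit time is the least `ν i / -μ i` over the decreasing coordinates. -/
lemma exists_ray_exit {ι : Type*} (S : Finset ι) {ν μ : ι → ℝ} (hν : ∀ i ∈ S, 0 < ν i)
    (hμ : ∃ i ∈ S, μ i < 0) :
    ∃ t : ℝ, 0 < t ∧ (∀ i ∈ S, 0 ≤ ν i + t * μ i) ∧ ∃ i ∈ S, ν i + t * μ i = 0 := by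
  obtain ⟨j, hj, hmin⟩ := (S.filter fun i => μ i < 0).exists_min_image (fun i => ν i / -μ i)
    (by obtain ⟨i, hi, h⟩ := hμ; exact ⟨i, by simp [hi, h]⟩)
  rw [Finset.mem_filter] at hj
  have hj' : 0 < -μ j := neg_pos.2 hj.2
  refine ⟨ν j / -μ j, div_pos (hν j hj.1) hj', fun i hi => ?_, j, hj.1, ?_⟩
  · by_cases h : μ i < 0
    · have := hmin i (by simp [hi, h])
      rw [le_div_iff₀ (neg_pos.2 h)] at this
      linarith
    · have := mul_nonneg (div_pos (hν j hj.1) hj').le (not_lt.1 h)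
      linarith [hν i hi]
  · have := div_mul_cancel₀ (ν j) hj'.ne'
    linarith

/-! ### Splitting certificates into circuits. -/

section Decomposition

variable {n : ℕ}

lemma exists_affine_relation {S : Finset (Fin n →₀ ℕ)}
    (h : ¬ AffineIndependent ℝ (fun α : S => toRealPt (α : Fin n →₀ ℕ))) :
    ∃ μ : (Fin n →₀ ℕ) → ℝ, (∀ α ∉ S, μ α = 0) ∧ ∑ α ∈ S, μ α = 0 ∧
      ∑ α ∈ S, μ α • toRealPt α = 0 ∧ (∃ α ∈ S, μ α < 0) ∧ ∃ α ∈ S, 0 < μ α := by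
  classical
  rw [affineIndependent_iff] at h
  push Not at h
  obtain ⟨s, w, h0, h1, e, he, hne⟩ := h
  let μ : (Fin n →₀ ℕ) → ℝ := fun α =>
    if h : α ∈ S then (if (⟨α, h⟩ : S) ∈ s then w ⟨α, h⟩ else 0) else 0
  have hμ : ∀ α : S, μ α = if α ∈ s then w α else 0 := fun α => by simp [μ]
  have hsum : ∑ α ∈ S, μ α = 0 := by
    rw [← Finset.sum_coe_sort S μ]
    simp only [hμ, Finset.sum_ite_mem, Finset.univ_inter]
    exact h0
  have hμe : μ e ≠ 0 := by rwa [hμ, if_pos he]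
  refine ⟨μ, fun α hα => by simp [μ, hα], hsum, ?_, ?_, ?_⟩
  · rw [← Finset.sum_coe_sort S fun α => μ α • toRealPt α]
    simp only [hμ, ite_smul, zero_smul, Finset.sum_ite_mem, Finset.univ_inter]
    exact h1
  · by_contra hcon
    push Not at hcon
    exact hμe ((Finset.sum_eq_zero_iff_of_nonneg hcon).1 hsum e e.2)
  · by_contra hcon
    push Not at hcon
    exact hμe ((Finset.sum_eq_zero_iff_of_nonpos hcon).1 hsum e e.2)

/-- A weighted geometric mean inequality certificate splits into circuits. -/
lemma certificate_mem {A : Finset (Fin n →₀ ℕ)} {β : Fin n →₀ ℕ}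
    {C : Set (MvPolynomial (Fin n) ℝ)} (hC : SOCRep C)
    (hcirc : ∀ T ⊆ A, InSimplexInterior T β → circuitCone T β ⊆ C)
    {r : (Fin n →₀ ℕ) → ℝ} (hr : ∀ α ∈ A, 0 < r α) (k : ℕ) :
    ∀ (ν : (Fin n →₀ ℕ) → ℝ) (d : ℝ), (A.filter fun α => 0 < ν α).card = k →
      IsConvexWeight A β ν → |d| ≤ ∏ α ∈ A, r α ^ ν α →
      ∑ α ∈ A, monomial α (ν α * r α) - monomial β d ∈ C := by
  induction k using Nat.strong_induction_on with
  | _ k ih =>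
  intro ν d hk hν hd
  set S := A.filter fun α => 0 < ν α with hS
  have hSA : S ⊆ A := Finset.filter_subset _ _
  have hSpos : ∀ α ∈ S, 0 < ν α := fun α hα => (Finset.mem_filter.1 hα).2
  have hzero : ∀ α ∈ A, α ∉ S → ν α = 0 := fun α hα hαS =>
    le_antisymm (not_lt.1 fun h => hαS (Finset.mem_filter.2 ⟨hα, h⟩)) (hν.nonneg α hα)
  have hνS : IsConvexWeight S β ν :=
    ⟨fun α hα => (hSpos α hα).le,
      (Finset.sum_subset hSA fun α h1 h2 => hzero α h1 h2).trans hν.sum_eq_one,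
      (Finset.sum_subset hSA fun α h1 h2 => by rw [hzero α h1 h2, zero_smul]).trans hν.sum_smul⟩
  by_cases hind : AffineIndependent ℝ (fun α : S => toRealPt (α : Fin n →₀ ℕ))
  · refine hcirc S hSA ⟨hind, ν, hSpos, hνS.sum_eq_one, hνS.sum_smul⟩
      ⟨ν, fun α => ν α * r α, d, hνS, hSpos,
        fun α hα => (mul_pos (hSpos α hα) (hr α (hSA hα))).le, ?_, ?_⟩
    · refine hd.trans_eq ?_
      rw [← Finset.prod_subset hSA fun α h1 h2 => by rw [hzero α h1 h2, Real.rpow_zero]]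
      refine Finset.prod_congr rfl fun α hα => ?_
      rw [mul_div_cancel_left₀ _ (hSpos α hα).ne']
    · rw [Finset.sum_subset hSA fun α h1 h2 => by simp [hzero α h1 h2]]
  · obtain ⟨μ, hμ0, hμsum, hμs, hneg, hpos⟩ := exists_affine_relation hind
    have hμA : ∑ α ∈ A, μ α = 0 :=
      (Finset.sum_subset hSA fun α _ h2 => hμ0 α h2).symm.trans hμsum
    have hμsA : ∑ α ∈ A, μ α • toRealPt α = 0 :=
      (Finset.sum_subset hSA fun α _ h2 => by rw [hμ0 α h2, zero_smul]).symm.trans hμs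
    -- Used with `s = 1` and `s = -1`: moving along either direction of the relation kills a weight
    -- and creates no new one.
    have step : ∀ s : ℝ, (∃ α ∈ S, s * μ α < 0) → ∃ t : ℝ, 0 < t ∧
        IsConvexWeight A β (fun α => ν α + t * (s * μ α)) ∧
        (A.filter fun α => 0 < ν α + t * (s * μ α)).card < k := by
      intro s hs
      obtain ⟨t, ht, hnn, j, hj, hj0⟩ := exists_ray_exit S (μ := fun α => s * μ α) hSpos hs
      refine ⟨t, ht, ⟨fun α hα => ?_, ?_, ?_⟩, ?_⟩
      · by_cases h : α ∈ S
        · exact hnn α h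
        · simp [hμ0 α h, hν.nonneg α hα]
      · rw [Finset.sum_add_distrib, ← Finset.mul_sum, ← Finset.mul_sum, hμA, hν.sum_eq_one]
        ring
      · simp only [add_smul, mul_smul, Finset.sum_add_distrib, ← Finset.smul_sum, hμsA,
          hν.sum_smul, smul_zero, add_zero]
      · rw [← hk]
        refine Finset.card_lt_card (Finset.ssubset_iff_of_subset ?_ |>.2 ⟨j, hj, ?_⟩)
        · intro α hα
          rw [Finset.mem_filter] at hα
          by_contra h
          rw [hzero α hα.1 h, hμ0 α h] at hα
          simp at hα
        · simp [hj0]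
    obtain ⟨t₁, ht₁, hν₁, hk₁⟩ := step 1 (by simpa using hneg)
    obtain ⟨t₂, ht₂, hν₂, hk₂⟩ := step (-1) (by simpa using hpos)
    set ν₁ := fun α => ν α + t₁ * (1 * μ α)
    set ν₂ := fun α => ν α + t₂ * (-1 * μ α)
    -- Chosen so that `a t₁ = b t₂`, which makes `ν` the average of the two endpoints.
    let a := t₂ / (t₁ + t₂)
    let b := t₁ / (t₁ + t₂)
    have ha : 0 < a := by positivity
    have hb : 0 < b := by positivity
    have hab : a + b = 1 := by
      simp only [a, b]
      field_simp
      ring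
    have hcomb : ∀ α, ν α = a * ν₁ α + b * ν₂ α := fun α => by
      simp only [a, b, ν₁, ν₂]
      field_simp
      ring
    let D₁ := ∏ α ∈ A, r α ^ ν₁ α
    let D₂ := ∏ α ∈ A, r α ^ ν₂ α
    have hD₁ : 0 < D₁ := Finset.prod_pos fun α hα => Real.rpow_pos_of_pos (hr α hα) _
    have hD₂ : 0 < D₂ := Finset.prod_pos fun α hα => Real.rpow_pos_of_pos (hr α hα) _
    -- The bound for `ν` is the geometric mean of `D₁` and `D₂`, hence at most `D`. So `d` can be
    -- shared out in proportion to `D₁` and `D₂`.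
    let D := a * D₁ + b * D₂
    have hD : 0 < D := by positivity
    have hdD : |d| ≤ D := by
      calc |d| ≤ ∏ α ∈ A, r α ^ ν α := hd
        _ = D₁ ^ a * D₂ ^ b := by
          rw [← Real.finsetProd_rpow _ _ fun α hα => Real.rpow_nonneg (hr α hα).le _,
            ← Real.finsetProd_rpow _ _ fun α hα => Real.rpow_nonneg (hr α hα).le _,
            ← Finset.prod_mul_distrib]
          refine Finset.prod_congr rfl fun α hα => ?_
          rw [← Real.rpow_mul (hr α hα).le, ← Real.rpow_mul (hr α hα).le,
            ← Real.rpow_add (hr α hα), hcomb α]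
          ring_nf
        _ ≤ D := Real.geom_mean_le_arith_mean2_weighted ha.le hb.le hD₁.le hD₂.le hab
    have hsplit : ∀ x, 0 < x → |d / D * x| ≤ x := fun x hx => by
      rw [abs_mul, abs_div, abs_of_pos hD, abs_of_pos hx]
      exact mul_le_of_le_one_left hx.le ((div_le_one hD).2 hdD)
    have m₁ := ih _ hk₁ ν₁ (d / D * D₁) rfl hν₁ (hsplit _ hD₁)
    have m₂ := ih _ hk₂ ν₂ (d / D * D₂) rfl hν₂ (hsplit _ hD₂)
    convert hC.add_mem (hC.smul_mem m₁ ha.le) (hC.smul_mem m₂ hb.le) using 1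
    have hd' : d = a * (d / D * D₁) + b * (d / D * D₂) := by
      have : d / D * D = d := div_mul_cancel₀ _ hD.ne'
      calc d = d / D * D := this.symm
        _ = _ := by simp only [D]; ring
    have e₁ : monomial β d = a • monomial β (d / D * D₁) + b • monomial β (d / D * D₂) := by
      rw [smul_monomial, smul_monomial, ← map_add, smul_eq_mul, smul_eq_mul, ← hd']
    have e₂ : ∑ α ∈ A, monomial α (ν α * r α) =
        a • ∑ α ∈ A, monomial α (ν₁ α * r α) + b • ∑ α ∈ A, monomial α (ν₂ α * r α) := by
      rw [Finset.smul_sum, Finset.smul_sum, ← Finset.sum_add_distrib]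
      refine Finset.sum_congr rfl fun α _ => ?_
      rw [smul_monomial, smul_monomial, ← map_add, smul_eq_mul, smul_eq_mul, hcomb α]
      ring_nf
    rw [e₁, e₂, smul_sub, smul_sub]
    abel

/-- A nonnegative signomial with at most one negative term is a sum of circuits supported on its
own exponents. -/
lemma age_mem {A : Finset (Fin n →₀ ℕ)} {β : Fin n →₀ ℕ}
    {C : Set (MvPolynomial (Fin n) ℝ)} (hC : SOCRep C)
    (hcirc : ∀ T ⊆ A, InSimplexInterior T β → circuitCone T β ⊆ C)
    (hmon : ∀ α ∈ A, ∀ t : ℝ, 0 ≤ t → monomial α t ∈ C)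
    {c : (Fin n →₀ ℕ) → ℝ} (hc : ∀ α ∈ A, 0 ≤ c α) {d : ℝ}
    (h : ∀ y : Fin n → ℝ, |d| * Real.exp (y ⬝ᵥ toRealPt β) ≤
      ∑ α ∈ A, c α * Real.exp (y ⬝ᵥ toRealPt α)) :
    ∑ α ∈ A, monomial α (c α) - monomial β d ∈ C := by
  classical
  rcases eq_or_ne d 0 with rfl | hd
  · rw [map_zero, sub_zero]
    exact hC.sum_mem fun α hα => hmon α hα _ (hc α hα)
  set S := A.filter fun α => 0 < c α with hS
  have hSA : S ⊆ A := Finset.filter_subset _ _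
  have hSpos : ∀ α ∈ S, 0 < c α := fun α hα => (Finset.mem_filter.1 hα).2
  have hzero : ∀ α ∈ A, α ∉ S → c α = 0 := fun α hα hαS =>
    le_antisymm (not_lt.1 fun h => hαS (Finset.mem_filter.2 ⟨hα, h⟩)) (hc α hα)
  -- Division by `exp (y ⬝ᵥ β)` shifts the exponents by `β`, so a balanced `ν` has barycentre `β`.
  -- Zero coefficients are dropped because the duality needs positive ones.
  obtain ⟨ν, ⟨hν0, hν1⟩, hνs, hlog⟩ := exists_entropy_dual
    (fun α : S => toRealPt (α : Fin n →₀ ℕ) - toRealPt β) (fun α => c α)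
    (fun α => hSpos α α.2) (abs_pos.2 hd) (fun y => by
      have h1 := h y
      rw [← Finset.sum_subset hSA fun α h1 h2 => by rw [hzero α h1 h2, zero_mul]] at h1
      rw [Finset.sum_coe_sort S fun α =>
        c α * Real.exp (y ⬝ᵥ (toRealPt α - toRealPt β))]
      simp only [dotProduct_sub, Real.exp_sub, mul_div_assoc']
      rwa [← Finset.sum_div, le_div_iff₀ (Real.exp_pos _)])
  let ν' : (Fin n →₀ ℕ) → ℝ := fun α => if h : α ∈ S then ν ⟨α, h⟩ else 0
  have hν' : ∀ α : S, ν' α = ν α := fun α => by simp [ν']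
  have hν'S : ∀ α ∉ S, ν' α = 0 := fun α hα => by simp [ν', hα]
  have hν'0 : ∀ α, 0 ≤ ν' α := fun α => by
    by_cases hα : α ∈ S
    · exact (hν' ⟨α, hα⟩).symm ▸ hν0 _
    · exact (hν'S α hα).ge
  simp only [← hν'] at hν1 hνs hlog
  rw [Finset.sum_coe_sort S ν'] at hν1
  rw [Finset.sum_coe_sort S fun α => ν' α • (toRealPt α - toRealPt β)] at hνs
  rw [Finset.sum_coe_sort S fun α => ν' α * Real.log (c α) + Real.negMulLog (ν' α)] at hlog
  have hw : IsConvexWeight A β ν' := by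
    refine ⟨fun α _ => hν'0 α, ?_, ?_⟩
    · rw [← Finset.sum_subset hSA fun α _ h2 => hν'S α h2, hν1]
    · rw [← Finset.sum_subset hSA fun α _ h2 => by rw [hν'S α h2, zero_smul]]
      simp only [smul_sub, Finset.sum_sub_distrib, ← Finset.sum_smul, hν1, one_smul] at hνs
      exact sub_eq_zero.1 hνs
  -- The default `1` keeps `r` positive and is harmless, since it is raised to the power `0`.
  let r : (Fin n →₀ ℕ) → ℝ := fun α => if 0 < ν' α then c α / ν' α else 1
  have hcS : ∀ α, 0 < ν' α → 0 < c α := fun α hα => by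
    by_cases hαS : α ∈ S
    · exact hSpos α hαS
    · rw [hν'S α hαS] at hα
      exact absurd hα (lt_irrefl _)
  have hr : ∀ α, 0 < r α := fun α => by
    by_cases hα : 0 < ν' α
    · simp only [r, if_pos hα]
      exact div_pos (hcS α hα) hα
    · simp [r, hα]
  have hdle : |d| ≤ ∏ α ∈ A, r α ^ ν' α := by
    have hterm : ∀ α ∈ S, ν' α * Real.log (c α) + Real.negMulLog (ν' α) =
        Real.log (r α ^ ν' α) := by
      intro α _
      rw [Real.log_rpow (hr α)]
      by_cases hα : 0 < ν' α
      · simp only [r, if_pos hα, Real.negMulLog]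
        rw [Real.log_div (hcS α hα).ne' hα.ne']
        ring
      · rw [le_antisymm (not_lt.1 hα) (hν'0 α)]
        simp
    rw [← Finset.prod_subset hSA fun α _ h2 => by rw [hν'S α h2, Real.rpow_zero]]
    rw [Finset.sum_congr rfl hterm, ← Real.log_prod fun α _ =>
      (Real.rpow_pos_of_pos (hr α) _).ne'] at hlog
    exact (Real.log_le_log_iff (abs_pos.2 hd)
      (Finset.prod_pos fun α _ => Real.rpow_pos_of_pos (hr α) _)).1 hlog
  have hmem := certificate_mem hC hcirc (fun α _ => hr α) _ ν' d rfl hw hdle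
  have hrest : ∑ α ∈ A, monomial α (c α - ν' α * r α) ∈ C := by
    refine hC.sum_mem fun α hα => hmon α hα _ ?_
    by_cases hα' : 0 < ν' α
    · simp only [r, if_pos hα']
      rw [mul_div_cancel₀ _ hα'.ne', sub_self]
    · rw [le_antisymm (not_lt.1 hα') (hν'0 α), zero_mul, sub_zero]
      exact hc α hα
  convert hC.add_mem hmem hrest using 1
  simp only [map_sub, Finset.sum_sub_distrib]
  abel

end Decomposition

/-! ### AGE decompositions without cancellation. -/

section AGE

variable {n : ℕ}

/-- Nonnegative polynomials all of whose coefficients off `o` are nonnegative and belong to even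
exponents. -/
def IsAGE (o : Option (Fin n →₀ ℕ)) (f : MvPolynomial (Fin n) ℝ) : Prop :=
  IsNonnegPoly f ∧ ∀ α, some α ≠ o → 0 ≤ coeff α f ∧ (coeff α f ≠ 0 → IsEvenPt α)

lemma isAGE_zero (o : Option (Fin n →₀ ℕ)) : IsAGE o (0 : MvPolynomial (Fin n) ℝ) :=
  ⟨fun x => by simp, fun α _ => by simp⟩

lemma IsAGE.add {o : Option (Fin n →₀ ℕ)} {f g : MvPolynomial (Fin n) ℝ} (hf : IsAGE o f)
    (hg : IsAGE o g) : IsAGE o (f + g) := by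
  refine ⟨fun x => by rw [map_add]; exact add_nonneg (hf.1 x) (hg.1 x), fun α hα => ?_⟩
  obtain ⟨h1, h2⟩ := hf.2 α hα
  obtain ⟨h3, h4⟩ := hg.2 α hα
  rw [coeff_add]
  refine ⟨add_nonneg h1 h3, fun h => ?_⟩
  by_cases h0 : coeff α f = 0
  · exact h4 fun h0' => h (by rw [h0, h0', add_zero])
  · exact h2 h0

lemma IsAGE.smul {o : Option (Fin n →₀ ℕ)} {f : MvPolynomial (Fin n) ℝ} (hf : IsAGE o f)
    {t : ℝ} (ht : 0 ≤ t) : IsAGE o (t • f) := by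
  refine ⟨fun x => by rw [smul_eval]; exact mul_nonneg ht (hf.1 x), fun α hα => ?_⟩
  obtain ⟨h1, h2⟩ := hf.2 α hα
  rw [coeff_smul, smul_eq_mul]
  exact ⟨mul_nonneg ht h1, fun h => h2 (right_ne_zero_of_mul h)⟩

/-- Adding a multiple of an AGE polynomial with another distinguished exponent `γ` only requires
control of the coefficient at `γ`. -/
lemma IsAGE.add_smul {o : Option (Fin n →₀ ℕ)} {γ : Fin n →₀ ℕ} {f g : MvPolynomial (Fin n) ℝ}
    (hf : IsAGE o f) (hg : IsAGE (some γ) g) (ho : some γ ≠ o) {t : ℝ} (ht : 0 ≤ t)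
    (hγ : 0 ≤ coeff γ f + t * coeff γ g)
    (hγ' : coeff γ f = 0 → coeff γ f + t * coeff γ g = 0) : IsAGE o (f + t • g) := by
  refine ⟨fun x => ?_, fun α hα => ?_⟩
  · rw [map_add, smul_eval]
    exact add_nonneg (hf.1 x) (mul_nonneg ht (hg.1 x))
  · obtain ⟨h1, h2⟩ := hf.2 α hα
    rw [coeff_add, coeff_smul, smul_eq_mul]
    by_cases hαγ : α = γ
    · subst hαγ
      exact ⟨hγ, fun h => h2 fun h0 => h (hγ' h0)⟩
    · obtain ⟨h3, h4⟩ := (hg.smul ht).2 α (by simpa using hαγ)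
      rw [coeff_smul, smul_eq_mul] at h3 h4
      refine ⟨add_nonneg h1 h3, fun h => ?_⟩
      by_cases h0 : coeff α f = 0
      · exact h4 fun h0' => h (by rw [h0, h0', add_zero])
      · exact h2 h0

lemma coeff_sum_monomial (T : Finset (Fin n →₀ ℕ))
    (c : (Fin n →₀ ℕ) → ℝ) (α : Fin n →₀ ℕ) :
    coeff α (∑ τ ∈ T, monomial τ (c τ)) = if α ∈ T then c α else 0 := by
  simp [coeff_sum, coeff_monomial]

lemma isAGE_of_circuit {f : MvPolynomial (Fin n) ℝ} (hf : IsCircuitPoly f)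
    (hnn : IsNonnegPoly f) : ∃ o, IsAGE o f := by
  classical
  obtain ⟨T, β, c, d, heven, hc, -, rfl⟩ := hf
  refine ⟨some β, hnn, fun α hα => ?_⟩
  have hne : β ≠ α := fun h => hα (by rw [h])
  rw [coeff_sub, coeff_sum_monomial, coeff_monomial, if_neg hne, sub_zero]
  split_ifs with h
  · exact ⟨(hc α h).le, fun _ => heven α h⟩
  · simp

lemma isAGE_of_monomialSquare {f : MvPolynomial (Fin n) ℝ} (hf : IsMonomialSquare f)
    (o : Option (Fin n →₀ ℕ)) : IsAGE o f := by
  classical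
  obtain ⟨τ, c, heven, hc, rfl⟩ := hf
  refine ⟨fun x => ?_, fun α hα => ?_⟩
  · rw [eval_monomial_fin, heven.prod_pow_eq_abs]
    positivity
  · rw [coeff_monomial]
    split_ifs with h
    · exact ⟨hc, fun _ => h ▸ heven⟩
    · simp

/-- AGE polynomials with a common distinguished exponent are closed under addition, so one summand
per exponent is enough; `none` takes the monomial squares. -/
lemma exists_finsupp_of_mem_SONC {f : MvPolynomial (Fin n) ℝ} (hf : f ∈ SONC n) :
    ∃ g : Option (Fin n →₀ ℕ) →₀ MvPolynomial (Fin n) ℝ, (∀ o, IsAGE o (g o)) ∧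
      f = g.sum fun _ p => p := by
  classical
  induction hf using AddSubmonoid.closure_induction with
  | mem f hf =>
    obtain ⟨o, ho⟩ : ∃ o, IsAGE o f := by
      rcases hf with ⟨h1, h2⟩ | h
      · exact isAGE_of_circuit h1 h2
      · exact ⟨none, isAGE_of_monomialSquare h none⟩
    refine ⟨Finsupp.single o f, fun o' => ?_, by simp⟩
    rw [Finsupp.single_apply]
    split_ifs with h
    · exact h ▸ ho
    · exact isAGE_zero _
  | zero => exact ⟨0, fun o => isAGE_zero o, by simp⟩
  | add f₁ f₂ _ _ h₁ h₂ =>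
    obtain ⟨g₁, hg₁, rfl⟩ := h₁
    obtain ⟨g₂, hg₂, rfl⟩ := h₂
    exact ⟨g₁ + g₂, fun o => (hg₁ o).add (hg₂ o),
      (Finsupp.sum_add_index' (fun _ => rfl) fun _ _ _ => rfl).symm⟩

/-- An AGE summand whose distinguished exponent has a nonnegative total coefficient can be absorbed
by the other summands. -/
lemma exists_absorb {I : Finset (Option (Fin n →₀ ℕ))} {γ : Fin n →₀ ℕ} (hγ : some γ ∉ I)
    (hnone : none ∈ I) {f : MvPolynomial (Fin n) ℝ}
    (hf : 0 ≤ coeff γ f) (hf' : coeff γ f ≠ 0 → IsEvenPt γ)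
    {g : Option (Fin n →₀ ℕ) → MvPolynomial (Fin n) ℝ}
    (hg : ∀ o ∈ I, IsAGE o (g o)) {h : MvPolynomial (Fin n) ℝ} (hh : IsAGE (some γ) h)
    (hsum : f = ∑ o ∈ I, g o + h) :
    ∃ g' : Option (Fin n →₀ ℕ) → MvPolynomial (Fin n) ℝ,
      (∀ o ∈ I, IsAGE o (g' o)) ∧ f = ∑ o ∈ I, g' o := by
  classical
  have hne : ∀ o ∈ I, some γ ≠ o := fun o ho h => hγ (h ▸ ho)
  set S := ∑ o ∈ I, coeff γ (g o)
  have hcf : coeff γ f = S + coeff γ h := by rw [hsum, coeff_add, coeff_sum]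
  have hs : ∀ o ∈ I, 0 ≤ coeff γ (g o) := fun o ho => ((hg o ho).2 γ (hne o ho)).1
  -- If the others do not use `γ`, then `h` has the coefficient of `f` there and joins the `none`
  -- summand. Otherwise `h` is distributed in proportion to their coefficients at `γ`.
  rcases (Finset.sum_nonneg hs).eq_or_lt with hS | hS
  · change 0 = S at hS
    rw [← hS, zero_add] at hcf
    have hage : IsAGE none h := by
      refine ⟨hh.1, fun α _ => ?_⟩
      by_cases hα : α = γ
      · rw [hα, ← hcf]
        exact ⟨hf, hf'⟩
      · exact hh.2 α (by simpa using hα)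
    refine ⟨Function.update g none (g none + h), fun o ho => ?_, ?_⟩
    · rcases eq_or_ne o none with rfl | hn
      · rw [Function.update_self]
        exact (hg _ ho).add hage
      · rw [Function.update_of_ne hn]
        exact hg o ho
    · rw [Finset.sum_update_of_mem hnone, hsum, ← Finset.add_sum_erase _ _ hnone,
        Finset.sdiff_singleton_eq_erase]
      abel
  · change 0 < S at hS
    refine ⟨fun o => g o + (coeff γ (g o) / S) • h, fun o ho => ?_, ?_⟩
    · refine (hg o ho).add_smul hh (hne o ho) (div_nonneg (hs o ho) hS.le) ?_ ?_
      · have : coeff γ (g o) + coeff γ (g o) / S * coeff γ h =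
            coeff γ (g o) / S * coeff γ f := by
          rw [hcf, mul_add, div_mul_cancel₀ _ hS.ne']
        rw [this]
        exact mul_nonneg (div_nonneg (hs o ho) hS.le) hf
      · intro h0
        simp [h0]
    · rw [Finset.sum_add_distrib, ← Finset.sum_smul, ← Finset.sum_div, div_self hS.ne', one_smul,
        hsum]

/-- Positive occurrences of an exponent with a nonpositive total coefficient can be eliminated. -/
lemma exists_eliminate {I : Finset (Option (Fin n →₀ ℕ))} {γ : Fin n →₀ ℕ} (hγ : some γ ∈ I)
    {f : MvPolynomial (Fin n) ℝ} (hf : coeff γ f ≤ 0)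
    {g : Option (Fin n →₀ ℕ) → MvPolynomial (Fin n) ℝ}
    (hg : ∀ o ∈ I, IsAGE o (g o)) (hsum : f = ∑ o ∈ I, g o) :
    ∃ g' : Option (Fin n →₀ ℕ) → MvPolynomial (Fin n) ℝ,
      (∀ o ∈ I, IsAGE o (g' o)) ∧ f = ∑ o ∈ I, g' o ∧
      (∀ o ∈ I, o ≠ some γ → coeff γ (g' o) = 0) ∧
      ∀ δ, (∀ o ∈ I, o ≠ some δ → coeff δ (g o) = 0) →
        ∀ o ∈ I, o ≠ some δ → coeff δ (g' o) = 0 := by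
  classical
  set J := I.erase (some γ)
  have hJ : ∀ o ∈ J, o ≠ some γ ∧ o ∈ I := fun o ho => Finset.mem_erase.1 ho
  set S := ∑ o ∈ J, coeff γ (g o)
  set e := coeff γ (g (some γ))
  have hs : ∀ o ∈ J, 0 ≤ coeff γ (g o) := fun o ho =>
    ((hg o (hJ o ho).2).2 γ (hJ o ho).1.symm).1
  have hS : 0 ≤ S := Finset.sum_nonneg hs
  have hcf : coeff γ f = e + S := by
    rw [hsum, coeff_sum, ← Finset.add_sum_erase _ _ hγ]
  rcases eq_or_ne e 0 with he | he
  · have hS0 : S = 0 := by linarith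
    refine ⟨g, hg, hsum, fun o ho hne => ?_, fun δ h => h⟩
    exact (Finset.sum_eq_zero_iff_of_nonneg hs).1 hS0 o (Finset.mem_erase.2 ⟨hne, ho⟩)
  -- Each other summand takes the multiple of `g (some γ)` that cancels its own coefficient at `γ`.
  -- In total the fraction `S / -e` is used, at most `1` because `e + S ≤ 0`.
  · have he' : 0 < -e := by
      rcases he.lt_or_gt with h | h <;> linarith
    let g' : Option (Fin n →₀ ℕ) → MvPolynomial (Fin n) ℝ := fun o =>
      if o = some γ then (1 - S / -e) • g (some γ)
      else g o + (coeff γ (g o) / -e) • g (some γ)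
    have hg'γ : g' (some γ) = (1 - S / -e) • g (some γ) := if_pos rfl
    have hg' : ∀ o, o ≠ some γ → g' o = g o + (coeff γ (g o) / -e) • g (some γ) :=
      fun o ho => if_neg ho
    have hz : ∀ x : ℝ, x + x / -e * e = 0 := fun x => by
      have := div_mul_cancel₀ x he'.ne'
      linarith
    refine ⟨g', fun o ho => ?_, ?_, fun o ho hne => ?_, fun δ hδ o ho hne => ?_⟩
    · rcases eq_or_ne o (some γ) with rfl | hne
      · rw [hg'γ]
        refine (hg _ ho).smul ?_
        rw [sub_nonneg, div_le_one he']
        linarith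
      · rw [hg' o hne]
        have ho' : o ∈ J := Finset.mem_erase.2 ⟨hne, ho⟩
        refine (hg o ho).add_smul (hg _ hγ) hne.symm (div_nonneg (hs o ho') he'.le) ?_ ?_
        · exact (hz _).ge
        · exact fun _ => hz _
    · rw [← Finset.add_sum_erase _ _ hγ, hg'γ, Finset.sum_congr rfl fun o ho => hg' o (hJ o ho).1,
        Finset.sum_add_distrib, ← Finset.sum_smul, ← Finset.sum_div, hsum,
        ← Finset.add_sum_erase _ _ hγ, sub_smul, one_smul]
      abel
    · rw [hg' o hne, coeff_add, coeff_smul, smul_eq_mul]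
      exact hz _
    -- Exponents eliminated earlier stay eliminated: for `δ ≠ γ` the added multiple has no `δ` term,
    -- and for `δ = γ` its factor is zero.
    · rcases eq_or_ne o (some γ) with rfl | hoγ
      · rw [hg'γ, coeff_smul, hδ _ ho hne, smul_zero]
      · rw [hg' o hoγ, coeff_add, coeff_smul, hδ o ho hne, zero_add, smul_eq_mul]
        rcases eq_or_ne δ γ with rfl | hδγ
        · rw [hδ o ho hne, zero_div, zero_mul]
        · rw [hδ _ hγ (by simpa using hδγ.symm), mul_zero]

/-- A SONC polynomial decomposes without cancellation. -/
lemma exists_decomposition {f : MvPolynomial (Fin n) ℝ} (hf : f ∈ SONC n)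
    (B E : Finset (Fin n →₀ ℕ)) (hEB : E ⊆ B)
    (hB : ∀ γ ∉ B, 0 ≤ coeff γ f ∧ (coeff γ f ≠ 0 → IsEvenPt γ))
    (hE : ∀ γ ∈ E, coeff γ f ≤ 0) :
    ∃ g : Option (Fin n →₀ ℕ) → MvPolynomial (Fin n) ℝ,
      (∀ o ∈ B.insertNone, IsAGE o (g o)) ∧ f = ∑ o ∈ B.insertNone, g o ∧
      ∀ γ ∈ E, ∀ o ∈ B.insertNone, o ≠ some γ → coeff γ (g o) = 0 := by
  classical
  -- `D` holds the distinguished exponents outside `B`, absorbed one by one.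
  have stage₁ : ∀ D : Finset (Fin n →₀ ℕ), Disjoint D B →
      (∃ g : Option (Fin n →₀ ℕ) → MvPolynomial (Fin n) ℝ,
        (∀ o ∈ (D ∪ B).insertNone, IsAGE o (g o)) ∧ f = ∑ o ∈ (D ∪ B).insertNone, g o) →
      ∃ g : Option (Fin n →₀ ℕ) → MvPolynomial (Fin n) ℝ,
        (∀ o ∈ B.insertNone, IsAGE o (g o)) ∧ f = ∑ o ∈ B.insertNone, g o := by
    intro D
    induction D using Finset.induction_on with
    | empty => simp
    | insert γ D hγD ih =>
      intro hdisj hex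
      rw [Finset.disjoint_insert_left] at hdisj
      refine ih hdisj.2 ?_
      obtain ⟨g, hg, hsum⟩ := hex
      have hγ : some γ ∉ (D ∪ B).insertNone := by simp [hγD, hdisj.1]
      have hins : (insert γ D ∪ B).insertNone = insert (some γ) (D ∪ B).insertNone := by
        ext o
        cases o <;> simp
      rw [hins] at hg hsum
      rw [Finset.sum_insert hγ, add_comm] at hsum
      exact exists_absorb hγ (by simp) (hB γ hdisj.1).1 (hB γ hdisj.1).2
        (fun o ho => hg o (Finset.mem_insert_of_mem ho)) (hg _ (Finset.mem_insert_self _ _)) hsum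
  obtain ⟨g₀, hg₀, hsum₀⟩ := exists_finsupp_of_mem_SONC hf
  obtain ⟨g₁, hg₁, hsum₁⟩ := stage₁ (g₀.support.eraseNone \ B) Finset.sdiff_disjoint
    ⟨g₀, fun o _ => hg₀ o, by
      rw [hsum₀]
      refine Finsupp.sum_of_support_subset _ (fun o ho => ?_) _ fun _ _ => rfl
      cases o with
      | none => simp
      | some γ =>
        rw [Finset.sdiff_union_self_eq_union]
        simpa using Or.inl (by simpa using ho)⟩
  induction E using Finset.induction_on with
  | empty => exact ⟨g₁, hg₁, hsum₁, by simp⟩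
  | insert γ E hγE ih =>
    obtain ⟨g, hg, hsum, hz⟩ := ih (fun δ hδ => hEB (Finset.mem_insert_of_mem hδ))
      fun δ hδ => hE δ (Finset.mem_insert_of_mem hδ)
    have hγB : γ ∈ B := hEB (Finset.mem_insert_self _ _)
    obtain ⟨g', hg', hsum', hγ', hpres⟩ := exists_eliminate (Finset.some_mem_insertNone.2 hγB)
      (hE γ (Finset.mem_insert_self _ _)) hg hsum
    refine ⟨g', hg', hsum', fun δ hδ => ?_⟩
    rcases Finset.mem_insert.1 hδ with rfl | hδ
    · exact hγ'
    · exact hpres δ (hz δ hδ)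

end AGE

lemma SOCRep.subset_finset_sum {W ι : Type*} [AddCommGroup W] [Module ℝ W] {s : Finset ι}
    {C : ι → Set W} (h : ∀ i ∈ s, SOCRep (C i)) {i : ι} (hi : i ∈ s) :
    C i ⊆ ∑ j ∈ s, C j := by
  classical
  intro x hx
  rw [← Finset.add_sum_erase s C hi]
  exact ⟨x, hx, 0, (SOCRep.finset_sum _ fun j hj => h j (Finset.mem_of_mem_erase hj)).zero_mem,
    add_zero x⟩

/-! ### Decomposition into circuits on the given support. -/

section Main

variable {n : ℕ}

lemma eval_exp_monomial (y : Fin n → ℝ) (α : Fin n →₀ ℕ) (c : ℝ) :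
    eval (fun i => Real.exp (y i)) (monomial α c) = c * Real.exp (y ⬝ᵥ toRealPt α) := by
  rw [eval_monomial_fin, dotProduct, Real.exp_sum]
  congr 1
  refine Finset.prod_congr rfl fun i _ => ?_
  rw [← Real.exp_nat_mul, toRealPt, mul_comm]

lemma eval_update_neg_monomial (x : Fin n → ℝ) (i : Fin n) (α : Fin n →₀ ℕ) (c : ℝ) :
    eval (Function.update x i (-x i)) (monomial α c) = (-1) ^ α i * eval x (monomial α c) := by
  rw [eval_monomial_fin, eval_monomial_fin, ← Finset.mul_prod_erase _ _ (Finset.mem_univ i),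
    ← Finset.mul_prod_erase _ _ (Finset.mem_univ i), Function.update_self, neg_pow,
    Finset.prod_congr rfl fun j hj => by
      rw [Function.update_of_ne (Finset.ne_of_mem_erase hj)]]
  ring

/-- Nonnegativity bounds the inner coefficient in absolute value, unless the inner monomial is a
square with a positive coefficient. -/
lemma IsNonnegPoly.abs_mul_exp_le {A : Finset (Fin n →₀ ℕ)} (hA : ∀ α ∈ A, IsEvenPt α)
    {β : Fin n →₀ ℕ} {c : (Fin n →₀ ℕ) → ℝ} {d : ℝ} (hd : IsEvenPt β → 0 ≤ d)
    (h : IsNonnegPoly (∑ α ∈ A, monomial α (c α) - monomial β d)) (y : Fin n → ℝ) :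
    |d| * Real.exp (y ⬝ᵥ toRealPt β) ≤ ∑ α ∈ A, c α * Real.exp (y ⬝ᵥ toRealPt α) := by
  have h1 := h fun i => Real.exp (y i)
  simp only [map_sub, map_sum, eval_exp_monomial, sub_nonneg] at h1
  rcases le_or_gt 0 d with h0 | h0
  · rwa [abs_of_nonneg h0]
  · have hβ : ¬ IsEvenPt β := fun he => absurd (hd he) (not_le.2 h0)
    simp only [IsEvenPt, not_forall, Nat.not_even_iff_odd] at hβ
    obtain ⟨i, hi⟩ := hβ
    -- Changing the sign of a coordinate in which `β` is odd flips the inner term and leaves the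
    -- even outer terms alone.
    have h2 := h (Function.update (fun i => Real.exp (y i)) i (-Real.exp (y i)))
    simp only [map_sub, map_sum, eval_update_neg_monomial (fun i => Real.exp (y i)),
      eval_exp_monomial, sub_nonneg, hi.neg_one_pow] at h2
    rw [Finset.sum_congr rfl fun α hα => by rw [(hA α hα i).neg_one_pow, one_mul]] at h2
    rw [abs_of_neg h0]
    linarith

/-- The sum of the cones of all circuits on `A` with inner exponents in `B`, and of all monomial
squares on `A`. -/
noncomputable def circuitSum (A B : Finset (Fin n →₀ ℕ)) : Set (MvPolynomial (Fin n) ℝ) :=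
  open Classical in
  ∑ α ∈ A, (monomial (R := ℝ) α) '' Set.Ici 0 +
    ∑ p ∈ (A.powerset ×ˢ B).filter (fun p => InSimplexInterior p.1 p.2), circuitCone p.1 p.2

lemma socRep_monomial (α : Fin n →₀ ℕ) :
    SOCRep ((monomial (R := ℝ) α) '' Set.Ici 0) :=
  (socRep_nonneg (LinearMap.id : ℝ →ₗ[ℝ] ℝ)).image _

lemma socRep_circuitSum (A B : Finset (Fin n →₀ ℕ)) : SOCRep (circuitSum A B) := by
  classical
  exact (SOCRep.finset_sum _ fun α _ => socRep_monomial α).add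
    (SOCRep.finset_sum _ fun p hp => socRep_circuitCone (Finset.mem_filter.1 hp).2)

lemma monomial_mem_circuitSum {A : Finset (Fin n →₀ ℕ)} (B : Finset (Fin n →₀ ℕ))
    {α : Fin n →₀ ℕ} (hα : α ∈ A) {t : ℝ} (ht : 0 ≤ t) : monomial α t ∈ circuitSum A B := by
  classical
  exact ⟨monomial α t, SOCRep.subset_finset_sum (fun α _ => socRep_monomial α) hα ⟨t, ht, rfl⟩,
    0, (SOCRep.finset_sum _ fun p hp =>
      socRep_circuitCone (Finset.mem_filter.1 hp).2).zero_mem, add_zero _⟩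

lemma circuitCone_subset_circuitSum {A B : Finset (Fin n →₀ ℕ)} {β : Fin n →₀ ℕ} (hβ : β ∈ B)
    {T : Finset (Fin n →₀ ℕ)} (hT : T ⊆ A) (h : InSimplexInterior T β) :
    circuitCone T β ⊆ circuitSum A B := by
  classical
  intro f hf
  refine ⟨0, (SOCRep.finset_sum _ fun α _ => socRep_monomial α).zero_mem, f, ?_, zero_add _⟩
  exact SOCRep.subset_finset_sum (C := fun p : Finset (Fin n →₀ ℕ) × (Fin n →₀ ℕ) =>
    circuitCone p.1 p.2) (i := (T, β))
    (fun p hp => socRep_circuitCone (Finset.mem_filter.1 hp).2) (by simp [hT, hβ, h]) hf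

lemma circuitSum_subset_SONC {A : Finset (Fin n →₀ ℕ)} (hA : ∀ α ∈ A, IsEvenPt α)
    (B : Finset (Fin n →₀ ℕ)) {f : MvPolynomial (Fin n) ℝ} (hf : f ∈ circuitSum A B) :
    f ∈ SONC n := by
  classical
  obtain ⟨p, hp, q, hq, rfl⟩ := hf
  rw [Set.mem_finsetSum] at hp hq
  obtain ⟨p', hp', rfl⟩ := hp
  obtain ⟨q', hq', rfl⟩ := hq
  refine add_mem (sum_mem fun α hα => ?_) (sum_mem fun r hr => ?_)
  · obtain ⟨t, ht, h⟩ := hp' hα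
    rw [← h]
    exact monomial_mem_SONC (hA α hα) ht
  · have h := Finset.mem_filter.1 hr
    exact circuitCone_subset_SONC h.2
      (fun α hα => hA α (Finset.mem_powerset.1 (Finset.mem_product.1 h.1).1 hα)) (hq' hr)

lemma eq_sum_monomial_sub {A : Finset (Fin n →₀ ℕ)} {β : Fin n →₀ ℕ} (hβ : β ∉ A)
    {g : MvPolynomial (Fin n) ℝ} (h : ∀ α ∉ A, α ≠ β → coeff α g = 0) :
    g = ∑ α ∈ A, monomial α (coeff α g) - monomial β (-coeff β g) := by
  classical
  ext α
  rw [coeff_sub, coeff_sum_monomial, coeff_monomial]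
  rcases eq_or_ne α β with rfl | hne
  · simp [hβ]
  · rw [if_neg hne.symm, sub_zero]
    split_ifs with hα
    · rfl
    · exact h α hα hne

/-- A SONC polynomial is a sum of circuit polynomials supported on its own support. -/
lemma mem_circuitSum_of_mem_SONC {A B₁ B₂ : Finset (Fin n →₀ ℕ)} (hA : ∀ α ∈ A, IsEvenPt α)
    (hB₂ : ∀ β ∈ B₂, ¬ IsEvenPt β) (hAB : Disjoint A B₁) {f : MvPolynomial (Fin n) ℝ}
    (hf : f ∈ SONC n) (hfA : ∀ α ∈ A, 0 ≤ coeff α f) (hfB : ∀ β ∈ B₁, coeff β f ≤ 0)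
    (hsupp : ∀ α ∉ A, α ∉ B₁ → α ∉ B₂ → coeff α f = 0) :
    f ∈ circuitSum A (B₁ ∪ B₂) := by
  classical
  have hC := socRep_circuitSum A (B₁ ∪ B₂)
  obtain ⟨g, hg, hsum, hz⟩ := exists_decomposition hf (B₁ ∪ B₂) B₁ Finset.subset_union_left
    (fun γ hγ => by
      rw [Finset.mem_union, not_or] at hγ
      by_cases hγA : γ ∈ A
      · exact ⟨hfA γ hγA, fun _ => hA γ hγA⟩
      · have := hsupp γ hγA hγ.1 hγ.2
        exact ⟨this.ge, fun h => absurd this h⟩) hfB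
  -- Three reasons: elimination on `B₁`, parity on `B₂`, and elsewhere nonnegative coefficients with
  -- sum zero.
  have hzero : ∀ o ∈ (B₁ ∪ B₂).insertNone, ∀ α ∉ A, some α ≠ o → coeff α (g o) = 0 := by
    intro o ho α hα hne
    by_cases h1 : α ∈ B₁
    · exact hz α h1 o ho hne.symm
    by_cases h2 : α ∈ B₂
    · by_contra h
      exact hB₂ α h2 (((hg o ho).2 α hne).2 h)
    · have h0 := hsupp α hα h1 h2
      rw [hsum, coeff_sum] at h0
      refine (Finset.sum_eq_zero_iff_of_nonneg fun o' ho' => ?_).1 h0 o ho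
      refine ((hg o' ho').2 α fun h => ?_).1
      rw [← h, Finset.some_mem_insertNone, Finset.mem_union] at ho'
      exact ho'.elim h1 h2
  rw [hsum]
  refine hC.sum_mem fun o ho => ?_
  cases o with
  | none =>
    have : g none = ∑ α ∈ A, monomial α (coeff α (g none)) := by
      ext α
      rw [coeff_sum_monomial]
      split_ifs with hα
      · rfl
      · exact hzero none ho α hα (by simp)
    rw [this]
    exact hC.sum_mem fun α hα => monomial_mem_circuitSum _ hα ((hg none ho).2 α (by simp)).1
  | some β =>
    have hβ : β ∈ B₁ ∪ B₂ := Finset.some_mem_insertNone.1 ho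
    have hβA : β ∉ A := fun h => (Finset.mem_union.1 hβ).elim
      (fun h1 => Finset.disjoint_left.1 hAB h h1) fun h2 => hB₂ β h2 (hA β h)
    have heq := eq_sum_monomial_sub hβA fun α hα hne =>
      hzero (some β) ho α hα (by simpa using hne)
    have hne : ∀ α ∈ A, some α ≠ some β := fun α hα h => hβA (Option.some.inj h ▸ hα)
    rw [heq]
    refine age_mem hC (fun T hT h => circuitCone_subset_circuitSum hβ hT h)
      (fun α hα t ht => monomial_mem_circuitSum _ hα ht)
      (fun α hα => ((hg _ ho).2 α (hne α hα)).1)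
      (IsNonnegPoly.abs_mul_exp_le hA (fun he => ?_) (heq ▸ (hg _ ho).1))
    -- An even `β` lies in `B₁`; after elimination its whole coefficient, which is nonpositive, sits
    -- in `g (some β)`.
    have hβ1 : β ∈ B₁ := (Finset.mem_union.1 hβ).resolve_right fun h => hB₂ β h he
    have h1 : coeff β f = coeff β (g (some β)) := by
      rw [hsum, coeff_sum]
      exact Finset.sum_eq_single _ (fun o ho hne => hz β hβ1 o ho hne) fun h => absurd ho h
    have := hfB β hβ1
    linarith

end Main

/-! ### Assembling the lift. -/

/-- `supportedPoly` as a linear map of the coefficients. -/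
noncomputable def supportedPolyLinear {n : ℕ} (A B₁ B₂ : Finset (Fin n →₀ ℕ)) :
    (A → ℝ) × (B₁ → ℝ) × (B₂ → ℝ) →ₗ[ℝ] MvPolynomial (Fin n) ℝ where
  toFun := supportedPoly
  map_add' v w := by
    simp only [supportedPoly, Prod.fst_add, Prod.snd_add, Pi.add_apply, map_add,
      Finset.sum_add_distrib]
    abel
  map_smul' t v := by
    simp only [supportedPoly, Prod.smul_fst, Prod.smul_snd, Pi.smul_apply, RingHom.id_apply,
      smul_sub, smul_add, Finset.smul_sum, smul_monomial]

lemma coeff_sum_coe {n : ℕ} (T : Finset (Fin n →₀ ℕ)) (c : T → ℝ) (α : Fin n →₀ ℕ) :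
    coeff α (∑ τ : T, monomial (τ : Fin n →₀ ℕ) (c τ)) = if h : α ∈ T then c ⟨α, h⟩ else 0 := by
  classical
  simp only [coeff_sum, coeff_monomial]
  split_ifs with h
  · rw [Finset.sum_eq_single ⟨α, h⟩ (fun τ _ hτ => if_neg fun h' => hτ (Subtype.ext h'))
      (by simp), if_pos rfl]
  · exact Finset.sum_eq_zero fun τ _ => if_neg fun (h' : (τ : Fin n →₀ ℕ) = α) => h (h' ▸ τ.2)

theorem theorem1p1 (n : ℕ) (A B₁ B₂ : Finset (Fin n →₀ ℕ))
    (hA : ∀ α ∈ A, IsEvenPt α)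
    (hB₁ : ∀ β ∈ B₁, toRealPt β ∈ latticeConv A ∧ IsEvenPt β)
    (hB₂ : ∀ β ∈ B₂, toRealPt β ∈ latticeConv A ∧ ¬ IsEvenPt β)
    (hAB : Disjoint A B₁) :
    ∃ k : ℕ, HasConeLift psdTwo k (SONCCone A B₁ B₂) ∧
      HasConeLift (rotatedSOC 1) k (SONCCone A B₁ B₂) := by
  suffices h : SOCRep (SONCCone A B₁ B₂) by
    obtain ⟨k, hk⟩ := h
    exact ⟨k, hk.psdTwo, hk.rotatedSOC⟩
  let W := (A → ℝ) × (B₁ → ℝ) × (B₂ → ℝ)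
  have r₁ := SOCRep.forall_mem (W := W) Finset.univ (C := fun α : A => {v | 0 ≤ v.1 α})
    fun α _ => socRep_nonneg (LinearMap.proj (φ := fun _ => ℝ) α ∘ₗ
      LinearMap.fst ℝ (A → ℝ) ((B₁ → ℝ) × (B₂ → ℝ)))
  have r₂ := SOCRep.forall_mem (W := W) Finset.univ (C := fun β : B₁ => {v | 0 ≤ v.2.1 β})
    fun β _ => socRep_nonneg
      (LinearMap.proj (φ := fun _ => ℝ) β ∘ₗ LinearMap.fst ℝ (B₁ → ℝ) (B₂ → ℝ) ∘ₗ
        LinearMap.snd ℝ (A → ℝ) ((B₁ → ℝ) × (B₂ → ℝ)))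
  have r₃ := (socRep_circuitSum A (B₁ ∪ B₂)).preimage (supportedPolyLinear A B₁ B₂)
  convert (r₁.inter r₂).inter r₃ using 1
  ext v
  have hAB₂ : ∀ α ∈ A, α ∉ B₂ := fun α hα h => (hB₂ α h).2 (hA α hα)
  have hcoeff : ∀ α, coeff α (supportedPoly v) = (if h : α ∈ A then v.1 ⟨α, h⟩ else 0) -
      ((if h : α ∈ B₁ then v.2.1 ⟨α, h⟩ else 0) + if h : α ∈ B₂ then v.2.2 ⟨α, h⟩ else 0) := by
    intro α
    rw [supportedPoly, coeff_sub, coeff_add, coeff_sum_coe, coeff_sum_coe, coeff_sum_coe]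
  constructor
  · rintro ⟨h1, h2, h3⟩
    refine ⟨⟨fun α _ => h1 α, fun β _ => h2 β⟩, ?_⟩
    change supportedPoly v ∈ circuitSum A (B₁ ∪ B₂)
    refine mem_circuitSum_of_mem_SONC hA (fun β hβ => (hB₂ β hβ).2) hAB h3
      (fun α hα => ?_) (fun β hβ => ?_) fun α hα hα₁ hα₂ => ?_
    · rw [hcoeff, dif_pos hα, dif_neg (Finset.disjoint_left.1 hAB hα), dif_neg (hAB₂ α hα)]
      simpa using h1 ⟨α, hα⟩
    · rw [hcoeff, dif_pos hβ, dif_neg (Finset.disjoint_right.1 hAB hβ),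
        dif_neg fun h => (hB₂ β h).2 (hB₁ β hβ).2]
      simpa using h2 ⟨β, hβ⟩
    · rw [hcoeff, dif_neg hα, dif_neg hα₁, dif_neg hα₂]
      simp
  · rintro ⟨⟨h1, h2⟩, h3⟩
    exact ⟨fun α => h1 α (Finset.mem_univ _), fun β => h2 β (Finset.mem_univ _),
      circuitSum_subset_SONC hA _ h3⟩
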